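/- Write $\langle x\rangle=1+|x|$ and $\mathbb T=\mathbb R/2\pi\mathbb Z$, and let $\widehat u(n,\tau)$, $(n,\tau)\in\mathbb Z\times\mathbb R$, denote the space-time Fourier transform of a tempered distribution $u$ on $\mathbb T\times\mathbb R$. For $\alpha,s,s_1,s_2\in\mathbb R$ set $$\|v\|_{Y_\alpha^{s_1,s_2}}=\|\langle n\rangle^{s_1}\langle\tau-\alpha n^3\rangle^{1/2}\widehat v\|_{L^2_nL^2_\tau}+\|\langle n\rangle^{s_1}\widehat v\|_{L^2_nL^1_\tau}+\|\langle n\rangle^{s_2}\langle\tau-\alpha n^3\rangle^{1/2}\widehat v\|_{L^\infty_nL^2_\tau}+\|\langle n\rangle^{s_2}\widehat v\|_{L^\infty_nL^1_\tau},$$ $$\|u\|_{Z^{s}}=\|\langle n\rangle^{s}\langle\tau-n^3\rangle^{-1/2}\widehat u\|_{L^2_nL^2_\tau}+\|\langle n\rangle^{s}\langle\tau-n^3\rangle^{-1}\widehat u\|_{L^2_nL^1_\tau}.$$ A real number $\rho$ is of type $\nu$ if there is $K>0$ with $|\rho-m/n|\ge K|n|^{-2-\nu}$ for all integers $m$ and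 $n\neq0$. Its minimal type index $\nu_\rho\in[0,\infty]$ is $\infty$ if $\rho\in\mathbb Q$, and otherwise $\inf\{\nu>0:\rho\text{ is of type }\nu\}$ (with $\inf\emptyset=\infty$). Let $\alpha\in(0,4)\setminus\{1\}$ and $c_1=\frac12+\frac{\sqrt{-3+12\alpha^{-1}}}{6}$. Assume that $\nu_{c_1}<1$, $\frac14\le s_1<\frac12<s_2<1$ and $s_2>\frac12+\frac12\nu_{c_1}$. Then there is a constant $C>0$, depending only on $\alpha,s_1,s_2$, such that for all $v_1,v_2\in L^2(\mathbb T\times\mathbb R)$ with finite $Y_\alpha^{s_1,s_2}$ norm (in particular for all elements of the completion of the Schwartz class on $\mathbb T\times\mathbb R$ in this norm) $$\|\partial_x(v_1v_2)\|_{Z^{s_1}}\le C\,\|v_1\|_{Y_\alpha^{s_1,s_2}}\|v_2\|_{Y_\alpha^{s_1,s_2}}.$$ Moreover, for every $\varepsilon>0$ there is $c>0$ such that $|n^3-\alpha n_1^3-\alpha n_2^3|\ge c\,|n|^{1-\nu_{c_1}-\varepsilon}$ for all integers $n_1,n_2$ with $n=n_1+n_2\neq0$. -/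

import Mathlib

open MeasureTheory
open scoped ENNReal SchwartzMap

noncomputable section

namespace KdVSystem

/-! ### Diophantine conditions -/

/-- `ρ` is of type `ν`: there is `K > 0` with `|ρ - m / n| ≥ K / |n| ^ (2 + ν)` for all pairs of
integers `(m, n)` with `n ≠ 0`. -/
def IsOfType (ρ ν : ℝ) : Prop :=
  ∃ K : ℝ, 0 < K ∧ ∀ m n : ℤ, n ≠ 0 → K / |(n : ℝ)| ^ (2 + ν) ≤ |ρ - (m : ℝ) / (n : ℝ)|

open Classical in
/-- The minimal type index of `ρ`: it is `∞` for rational `ρ`, and for irrational `ρ` the infimum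
of the `ν > 0` such that `ρ` is of type `ν` (`∞` if there is none). -/
def minimalTypeIndex (ρ : ℝ) : ℝ≥0∞ :=
  if Irrational ρ then ⨅ (ν : ℝ) (_ : 0 < ν) (_ : IsOfType ρ ν), ENNReal.ofReal ν else ⊤

/-- The root `c₁ = 1 / 2 + √(-3 + 12 / α) / 6` of the resonance equation
`1 - α c³ - α (1 - c)³ = 0`. -/
def c₁ (α : ℝ) : ℝ := 1 / 2 + Real.sqrt (-3 + 12 * α⁻¹) / 6

/-! ### Space-time functions, distributions and their Fourier transforms -/

instance fact_two_pi_pos : Fact (0 < 2 * Real.pi) := ⟨Real.two_pi_pos⟩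

/-- The torus `ℝ / 2πℤ` (with Lebesgue measure of total mass `2π`). -/
abbrev Torus : Type := AddCircle (2 * Real.pi)

/-- Distributions on `Torus × ℝ`, as functionals acting on test functions. -/
abbrev SpaceTimeDistribution : Type := (Torus × ℝ → ℂ) → ℂ

/-- The distribution `φ ↦ ∫ u φ dx dt` given by a function `u` on `Torus × ℝ`. -/
def ofFunction (u : Torus × ℝ → ℂ) : SpaceTimeDistribution :=
  fun φ => ∫ p : Torus × ℝ, u p * φ p

/-- The classical partial derivative `∂ₓ φ` of a function on `Torus × ℝ`. -/
def partialX (φ : Torus × ℝ → ℂ) : Torus × ℝ → ℂ :=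
  fun p => deriv (fun h : ℝ => φ (p.1 + (h : Torus), p.2)) 0

/-- The distributional derivative `⟨∂ₓ T, φ⟩ = -⟨T, ∂ₓ φ⟩`. -/
def distribX (T : SpaceTimeDistribution) : SpaceTimeDistribution :=
  fun φ => -T (partialX φ)

/-- The test function `(x, t) ↦ e^{-inx} ∫ ψ(τ) e^{-iτt} dτ` on `Torus × ℝ`. -/
def testFunction (n : ℤ) (ψ : 𝓢(ℝ, ℂ)) : Torus × ℝ → ℂ :=
  fun p => fourier (-n) p.1 * ∫ τ : ℝ, ψ τ * Complex.exp (-(Complex.I * τ * p.2))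

/-- `F` is the space-time Fourier transform of `T` in the sense of tempered distributions, with the
convention `û(n, τ) = ∫∫ u(x, t) e^{-i(nx + τt)} dx dt`. It is determined by `T` for every `n` and
almost every `τ`. -/
def IsFourierTransform (T : SpaceTimeDistribution) (F : ℤ → ℝ → ℂ) : Prop :=
  ∀ (n : ℤ) (ψ : 𝓢(ℝ, ℂ)), Integrable (fun τ : ℝ => F n τ * ψ τ) ∧
    T (testFunction n ψ) = ∫ τ : ℝ, F n τ * ψ τ

/-! ### Mixed norms on `ℤ × ℝ` -/

/-- The norm of `L²_n L²_τ`. -/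
def normL2L2 (G : ℤ → ℝ → ℝ≥0∞) : ℝ≥0∞ := (∑' n : ℤ, ∫⁻ τ : ℝ, G n τ ^ 2) ^ (1 / 2 : ℝ)

/-- The norm of `L²_n L¹_τ`. -/
def normL2L1 (G : ℤ → ℝ → ℝ≥0∞) : ℝ≥0∞ := (∑' n : ℤ, (∫⁻ τ : ℝ, G n τ) ^ 2) ^ (1 / 2 : ℝ)

/-- The norm of `L^∞_n L²_τ`. -/
def normLinfL2 (G : ℤ → ℝ → ℝ≥0∞) : ℝ≥0∞ := ⨆ n : ℤ, (∫⁻ τ : ℝ, G n τ ^ 2) ^ (1 / 2 : ℝ)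

/-- The norm of `L^∞_n L¹_τ`. -/
def normLinfL1 (G : ℤ → ℝ → ℝ≥0∞) : ℝ≥0∞ := ⨆ n : ℤ, ∫⁻ τ : ℝ, G n τ

/-- The bracket `⟨x⟩ = 1 + |x|`. -/
def bracket (x : ℝ) : ℝ := 1 + |x|

/-- The weighted modulus `⟨n⟩^s ⟨τ - α n³⟩^b |F(n, τ)|`. -/
def weighted (α s b : ℝ) (F : ℤ → ℝ → ℂ) : ℤ → ℝ → ℝ≥0∞ :=
  fun n τ =>
    ENNReal.ofReal (bracket (n : ℝ) ^ s * bracket (τ - α * (n : ℝ) ^ 3) ^ b) * ‖F n τ‖ₑ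

/-! ### The function spaces, first on the Fourier side -/

/-- `‖⟨n⟩^{s₁} ⟨τ - α n³⟩^{1/2} F‖_{L²_n L²_τ} + ‖⟨n⟩^{s₁} F‖_{L²_n L¹_τ}` plus
`‖⟨n⟩^{s₂} ⟨τ - α n³⟩^{1/2} F‖_{L^∞_n L²_τ} + ‖⟨n⟩^{s₂} F‖_{L^∞_n L¹_τ}`. -/
def hatNormY (α s₁ s₂ : ℝ) (F : ℤ → ℝ → ℂ) : ℝ≥0∞ :=
  (normL2L2 (weighted α s₁ (1 / 2) F) + normL2L1 (weighted α s₁ 0 F)) +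
    (normLinfL2 (weighted α s₂ (1 / 2) F) + normLinfL1 (weighted α s₂ 0 F))

/-- `‖⟨n⟩^s ⟨τ - n³⟩^{-1/2} F‖_{L²_n L²_τ} + ‖⟨n⟩^s ⟨τ - n³⟩^{-1} F‖_{L²_n L¹_τ}`. -/
def hatNormZ (s : ℝ) (F : ℤ → ℝ → ℂ) : ℝ≥0∞ :=
  normL2L2 (weighted 1 s (-(1 / 2)) F) + normL2L1 (weighted 1 s (-1) F)

/-- The norm of `Y_α^{s₁,s₂}`. As the Fourier transform is unique almost everywhere, the infimum is
over one value, and it is `∞` if there is no Fourier transform that is a function. -/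
def normY (α s₁ s₂ : ℝ) (T : SpaceTimeDistribution) : ℝ≥0∞ :=
  ⨅ (F : ℤ → ℝ → ℂ) (_ : IsFourierTransform T F), hatNormY α s₁ s₂ F

/-- The norm of `Z^s`, with the same convention as for `normY`. -/
def normZ (s : ℝ) (T : SpaceTimeDistribution) : ℝ≥0∞ :=
  ⨅ (F : ℤ → ℝ → ℂ) (_ : IsFourierTransform T F), hatNormZ s F

/-- `v ∈ Y_α^{s₁,s₂}`. For `s₁ ≥ 0` the weights in the first term of the norm are at least `1`, so
that all elements of this space, and of the completion of the Schwartz class in its norm, are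
functions in `L²(Torus × ℝ)`. -/
def MemY (α s₁ s₂ : ℝ) (v : Torus × ℝ → ℂ) : Prop :=
  MemLp v 2 ∧ normY α s₁ s₂ (ofFunction v) < ⊤

end KdVSystem

end

/-!
With `c = c₁ α` and `n = n₁ + n₂`, the resonance function factors as
`n³ - α n₁³ - α n₂³ = 3 α n (n₁ - c n) (n₂ - c n)` (`resonance_eq`). The last two factors add up to
`(1 - 2 c) n` with `c > 1 / 2`, so the larger of them is comparable to `n` or bigger, while the
smaller one is at least of size `|n|^(-1 - ν)` when `c` is of type `ν`. This gives the lower bound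
`|n|^(1 - ν)` for the resonance function (`abs_resonance_ge_rpow`), for each `ν` above the minimal
type index.

For the bilinear estimate, the Fourier transform of `∂ₓ (v₁ v₂)` is, up to a constant, `n` times
the convolution of the Fourier transforms of `v₁` and `v₂` (`isFourierTransform_distribX_mul`).
The modulations satisfy
`τ - n³ = (τ₁ - α n₁³) + (τ₂ - α n₂³) - (n³ - α n₁³ - α n₂³)`,
so the square root of the bracket of the resonance function is at most the sum of the square roots
of the brackets of the three modulations. With Young's inequality in `τ` each interaction of spatial
frequencies `n₁`, `n₂` thus gains the power `-1 / 2` of the bracket of the resonance function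
(`lintegral_weighted_lconv_sq_le`, `lintegral_weighted_lconv_le`), and the claim becomes a bilinear
estimate for sequences (`exists_sequence_bound`).

There the frequencies split in two. If one of the factors `n₁ - c n`, `n₂ - c n` is at most
`1` in size, then `n₁` and `n₂` are comparable to `n` and nearly determined by it. The Diophantine
bound leaves a loss of `|n|^(1 / 2 + ν / 2)`, which the `ℓ^∞` norm with weight `s₂` absorbs, and
Schur's test closes the estimate. Otherwise the resonance function is at least of the size of `n²`
times the smaller of these factors, and the Cauchy-Schwarz inequality applies, because with
`s₁ ≥ 1 / 4` the square of the remaining kernel is summable in `n₁`, uniformly in `n`.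

That the convolution is the Fourier transform of the product is shown one variable at a time:
since the Fourier transform of `v₁` is in `L¹` in `τ`, Fourier inversion in time identifies the
spatial Fourier coefficients of `v₁` at almost every time (`spatialCoeff_ae_eq`), and Parseval's
identity on the circle gives those of the product.
-/

namespace KdVSystem

/-! ### The resonance function -/

/-- Above the minimal type index there are exponents of which the number is of type, since the index
is an infimum. -/
lemma exists_isOfType_lt {ρ μ : ℝ} (hρ : minimalTypeIndex ρ ≠ ⊤)
    (hμ : (minimalTypeIndex ρ).toReal < μ) : ∃ ν, 0 < ν ∧ ν < μ ∧ IsOfType ρ ν := by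
  have hμ0 : 0 < μ := ENNReal.toReal_nonneg.trans_lt hμ
  have h : minimalTypeIndex ρ < ENNReal.ofReal μ :=
    (ENNReal.lt_ofReal_iff_toReal_lt hρ).2 hμ
  unfold minimalTypeIndex at h
  split_ifs at h with hirr
  · simp only [iInf_lt_iff] at h
    obtain ⟨ν, hν, hty, hlt⟩ := h
    exact ⟨ν, hν, (ENNReal.ofReal_lt_ofReal_iff hμ0).1 hlt, hty⟩
  · simp at h

lemma one_le_bracket (x : ℝ) : 1 ≤ bracket x := by
  simp [bracket]

lemma bracket_pos (x : ℝ) : 0 < bracket x := zero_lt_one.trans_le (one_le_bracket x)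

lemma half_lt_c₁ {α : ℝ} (h0 : 0 < α) (h4 : α < 4) : 1 / 2 < c₁ α := by
  have : 0 < -3 + 12 * α⁻¹ := by
    have : α * α⁻¹ = 1 := mul_inv_cancel₀ h0.ne'
    have h5 : 0 < α⁻¹ := inv_pos.2 h0
    nlinarith
  have := Real.sqrt_pos.2 this
  unfold c₁
  linarith

lemma c₁_equation {α : ℝ} (h0 : 0 < α) (h4 : α < 4) :
    3 * α * (c₁ α ^ 2 - c₁ α) = 1 - α := by
  have h1 : α * α⁻¹ = 1 := mul_inv_cancel₀ h0.ne'
  have h2 : 0 ≤ -3 + 12 * α⁻¹ := by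
    have h5 : 0 < α⁻¹ := inv_pos.2 h0
    nlinarith
  have h3 := Real.sq_sqrt h2
  unfold c₁
  set r := Real.sqrt (-3 + 12 * α⁻¹)
  have : 3 * α * ((1 / 2 + r / 6) ^ 2 - (1 / 2 + r / 6)) = α * (r ^ 2 - 9) / 12 := by ring
  rw [this, h3]
  linear_combination h1

lemma c₁_ne_one {α : ℝ} (h0 : 0 < α) (h4 : α < 4) (h1 : α ≠ 1) : c₁ α ≠ 1 := by
  intro h
  have := c₁_equation h0 h4
  rw [h] at this
  apply h1
  linarith

/-- The resonance function `n³ - α n₁³ - α n₂³`, for `n = n₁ + n₂`. -/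
def resonance (α : ℝ) (n₁ n₂ : ℤ) : ℝ :=
  ((n₁ + n₂ : ℤ) : ℝ) ^ 3 - α * (n₁ : ℝ) ^ 3 - α * (n₂ : ℝ) ^ 3

lemma resonance_eq {α : ℝ} (h0 : 0 < α) (h4 : α < 4) (n₁ n₂ : ℤ) :
    resonance α n₁ n₂ = 3 * α * ((n₁ + n₂ : ℤ) : ℝ) * ((n₁ : ℝ) - c₁ α * ((n₁ + n₂ : ℤ) : ℝ)) *
      ((n₂ : ℝ) - c₁ α * ((n₁ + n₂ : ℤ) : ℝ)) := by
  have := c₁_equation h0 h4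
  unfold resonance
  push_cast
  linear_combination (-((n₁ : ℝ) + n₂) ^ 3) * this

/-- The larger of the last two factors of the resonance function is at least comparable to `n`,
because they add up to `(1 - 2 c) n`. -/
lemma max_factor_ge {α : ℝ} (h0 : 0 < α) (h4 : α < 4) (n₁ n₂ : ℤ) :
    (c₁ α - 1 / 2) * |((n₁ + n₂ : ℤ) : ℝ)| ≤
      max |(n₁ : ℝ) - c₁ α * ((n₁ + n₂ : ℤ) : ℝ)| |(n₂ : ℝ) - c₁ α * ((n₁ + n₂ : ℤ) : ℝ)| := by
  have hc := half_lt_c₁ h0 h4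
  set n : ℝ := ((n₁ + n₂ : ℤ) : ℝ) with hn
  have hn' : n = n₁ + n₂ := by rw [hn]; push_cast; rfl
  have h1 : 2 * (c₁ α - 1 / 2) * |n| = |((n₁ : ℝ) - c₁ α * n) + ((n₂ : ℝ) - c₁ α * n)| := by
    rw [← abs_of_pos (show 0 < 2 * (c₁ α - 1 / 2) by linarith), ← abs_mul, ← abs_neg]
    congr 1
    rw [hn']; ring
  have h2 := abs_add_le ((n₁ : ℝ) - c₁ α * n) ((n₂ : ℝ) - c₁ α * n)
  have h3 := le_max_left |(n₁ : ℝ) - c₁ α * n| |(n₂ : ℝ) - c₁ α * n|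
  have h5 := le_max_right |(n₁ : ℝ) - c₁ α * n| |(n₂ : ℝ) - c₁ α * n|
  linarith

lemma abs_resonance_ge {α : ℝ} (h0 : 0 < α) (h4 : α < 4) (n₁ n₂ : ℤ) :
    3 * α * (c₁ α - 1 / 2) * |((n₁ + n₂ : ℤ) : ℝ)| ^ 2 *
      min |(n₁ : ℝ) - c₁ α * ((n₁ + n₂ : ℤ) : ℝ)| |(n₂ : ℝ) - c₁ α * ((n₁ + n₂ : ℤ) : ℝ)| ≤
      |resonance α n₁ n₂| := by
  have h := max_factor_ge h0 h4 n₁ n₂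
  rw [resonance_eq h0 h4, abs_mul, abs_mul, abs_mul, abs_of_pos (by positivity : 0 < 3 * α),
    mul_assoc _ |_| |_|, ← min_mul_max |(n₁ : ℝ) - _| |(n₂ : ℝ) - _|]
  set n : ℝ := ((n₁ + n₂ : ℤ) : ℝ) with hn
  set M := max |(n₁ : ℝ) - c₁ α * n| |(n₂ : ℝ) - c₁ α * n|
  set m := min |(n₁ : ℝ) - c₁ α * n| |(n₂ : ℝ) - c₁ α * n| with hm
  have hm0 : 0 ≤ m := le_min (abs_nonneg _) (abs_nonneg _)
  calc 3 * α * (c₁ α - 1 / 2) * |n| ^ 2 * m = 3 * α * |n| * m * ((c₁ α - 1 / 2) * |n|) := by ring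
    _ ≤ 3 * α * |n| * m * M := by gcongr
    _ = _ := by ring

lemma IsOfType.abs_sub_ge {ρ ν : ℝ} (h : IsOfType ρ ν) :
    ∃ K : ℝ, 0 < K ∧ ∀ m n : ℤ, n ≠ 0 → K * |(n : ℝ)| ^ (-1 - ν) ≤ |(m : ℝ) - ρ * n| := by
  obtain ⟨K, hK, h⟩ := h
  refine ⟨K, hK, fun m n hn => ?_⟩
  have hn' : (n : ℝ) ≠ 0 := by exact_mod_cast hn
  have hpos : 0 < |(n : ℝ)| := abs_pos.2 hn'
  have e : |(m : ℝ) - ρ * n| = |ρ - m / n| * |(n : ℝ)| := by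
    rw [← abs_mul, ← abs_neg]
    congr 1
    field_simp
    ring
  rw [e]
  calc K * |(n : ℝ)| ^ (-1 - ν) = K / |(n : ℝ)| ^ (2 + ν) * |(n : ℝ)| := by
        rw [show -1 - ν = -(2 + ν) + 1 by ring, Real.rpow_add hpos, Real.rpow_neg hpos.le,
          Real.rpow_one]
        ring
    _ ≤ _ := by gcongr; exact h m n hn

lemma abs_resonance_ge_rpow {α ν : ℝ} (h0 : 0 < α) (h4 : α < 4) (hν : IsOfType (c₁ α) ν) :
    ∃ κ : ℝ, 0 < κ ∧ ∀ n₁ n₂ : ℤ, n₁ + n₂ ≠ 0 →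
      κ * |((n₁ + n₂ : ℤ) : ℝ)| ^ (1 - ν) ≤ |resonance α n₁ n₂| := by
  obtain ⟨K, hK, h⟩ := hν.abs_sub_ge
  have hc := half_lt_c₁ h0 h4
  refine ⟨3 * α * (c₁ α - 1 / 2) * K, mul_pos (mul_pos (by positivity) (by linarith)) hK,
    fun n₁ n₂ hn => le_trans ?_ (abs_resonance_ge h0 h4 n₁ n₂)⟩
  have hmin := le_min (h n₁ _ hn) (h n₂ _ hn)
  have hn' : ((n₁ + n₂ : ℤ) : ℝ) ≠ 0 := by exact_mod_cast hn
  set n : ℝ := ((n₁ + n₂ : ℤ) : ℝ)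
  have hpos : 0 < |n| := abs_pos.2 hn'
  have hc' : 0 ≤ c₁ α - 1 / 2 := by linarith
  calc 3 * α * (c₁ α - 1 / 2) * K * |n| ^ (1 - ν)
      = 3 * α * (c₁ α - 1 / 2) * |n| ^ 2 * (K * |n| ^ (-1 - ν)) := by
        rw [show 1 - ν = 2 + (-1 - ν) by ring, Real.rpow_add hpos, Real.rpow_two]
        ring
    _ ≤ _ := by gcongr

/-! ### Kernel bounds -/

lemma summable_bracket_int : Summable fun n : ℤ => bracket (n : ℝ) ^ (-(3 / 2) : ℝ) := by
  refine Summable.of_nonneg_of_le (fun n => Real.rpow_nonneg (bracket_pos _).le _) (fun n => ?_)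
    ((Real.summable_one_div_int_add_rpow (1 / 2) (3 / 2)).2 (by norm_num))
  have h1 : (0 : ℝ) < |(n : ℝ) + 1 / 2| := by
    rw [abs_pos]
    intro h
    have h2 : ((2 * n + 1 : ℤ) : ℝ) = 0 := by push_cast; linarith
    have h3 : 2 * n + 1 = 0 := by exact_mod_cast h2
    omega
  have h2 : |(n : ℝ) + 1 / 2| ≤ bracket n := by
    refine (abs_add_le _ _).trans ?_
    unfold bracket
    rw [abs_of_pos (by norm_num : (0 : ℝ) < 1 / 2)]
    linarith
  rw [one_div, ← Real.rpow_neg h1.le]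
  exact Real.rpow_le_rpow_of_nonpos h1 h2 (by norm_num)

/-- The translates of a fixed summable power of the bracket are summable with a uniform bound. -/
lemma exists_tsum_bracket_le {c : ℝ} (hc : c ≠ 0) :
    ∃ C : ℝ, 0 ≤ C ∧ ∀ θ : ℝ,
      ∑' n : ℤ, ENNReal.ofReal (bracket (c * n - θ) ^ (-(3 / 2) : ℝ)) ≤ ENNReal.ofReal C := by
  set μ : ℝ := min 1 |c| with hμ
  have hμ0 : 0 < μ := lt_min one_pos (abs_pos.2 hc)
  set D : ℝ := (μ / 2) ^ (-(3 / 2) : ℝ)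
  have hD : 0 ≤ D := Real.rpow_nonneg (by positivity) _
  set S : ℝ := ∑' n : ℤ, bracket (n : ℝ) ^ (-(3 / 2) : ℝ)
  have hS : 0 ≤ S := tsum_nonneg fun n => Real.rpow_nonneg (bracket_pos _).le _
  refine ⟨D * S, mul_nonneg hD hS, fun θ => ?_⟩
  -- Up to constants, the sum is a translate by `p` of the one for `c = 1` and `θ = 0`.
  set p : ℤ := ⌊θ / c⌋ with hp
  have key : ∀ n : ℤ, bracket (c * n - θ) ^ (-(3 / 2) : ℝ) ≤
      D * bracket ((n - p : ℤ) : ℝ) ^ (-(3 / 2) : ℝ) := by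
    intro n
    have h1 : |(n : ℝ) - p| ≤ |(n : ℝ) - θ / c| + 1 := by
      have e : (n : ℝ) - p = ((n : ℝ) - θ / c) + (θ / c - p) := by ring
      rw [e]
      refine (abs_add_le _ _).trans ?_
      have h2 : (p : ℝ) ≤ θ / c := Int.floor_le _
      have h3 : θ / c < p + 1 := Int.lt_floor_add_one _
      have : |θ / c - p| ≤ 1 := abs_le.2 ⟨by linarith, by linarith⟩
      linarith
    have h2 : μ * |(n : ℝ) - θ / c| ≤ |c * n - θ| := by
      have e : c * n - θ = c * ((n : ℝ) - θ / c) := by field_simp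
      rw [e, abs_mul]
      exact mul_le_mul_of_nonneg_right (min_le_right _ _) (abs_nonneg _)
    have h3 : μ / 2 * bracket ((n - p : ℤ) : ℝ) ≤ bracket (c * n - θ) := by
      unfold bracket
      push_cast
      have h4 : μ ≤ 1 := min_le_left _ _
      have h5 := mul_le_mul_of_nonneg_left h1 hμ0.le
      nlinarith [mul_nonneg hμ0.le (abs_nonneg ((n : ℝ) - θ / c))]
    rw [← Real.mul_rpow (by positivity) (bracket_pos _).le]
    exact Real.rpow_le_rpow_of_nonpos (mul_pos (by positivity) (bracket_pos _)) h3 (by norm_num)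
  calc ∑' n : ℤ, ENNReal.ofReal (bracket (c * n - θ) ^ (-(3 / 2) : ℝ))
      ≤ ∑' n : ℤ, ENNReal.ofReal D *
          ENNReal.ofReal (bracket ((n - p : ℤ) : ℝ) ^ (-(3 / 2) : ℝ)) := by
        refine ENNReal.tsum_le_tsum fun n => ?_
        rw [← ENNReal.ofReal_mul hD]
        exact ENNReal.ofReal_le_ofReal (key n)
    _ = ENNReal.ofReal D * ∑' n : ℤ, ENNReal.ofReal (bracket (n : ℝ) ^ (-(3 / 2) : ℝ)) := by
        rw [ENNReal.tsum_mul_left]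
        congr 1
        exact (Equiv.subRight p).tsum_eq
          fun n : ℤ => ENNReal.ofReal (bracket (n : ℝ) ^ (-(3 / 2) : ℝ))
    _ = ENNReal.ofReal (D * S) := by
        rw [ENNReal.ofReal_mul hD, ENNReal.ofReal_tsum_of_nonneg
          (fun n => Real.rpow_nonneg (bracket_pos _).le _) summable_bracket_int]

/-- The kernel that majorizes, up to a constant, the indicator of the resonant frequencies, where one
of `n₁`, `n₂` is within distance `1` of `c (n₁ + n₂)`. It is summable when `n₁ + n₂` is held fixed
and, for `c ≠ 0, 1`, also when `n₂` is held fixed. -/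
noncomputable def resonantKernel (c : ℝ) (n₁ n₂ : ℤ) : ℝ :=
  bracket ((n₁ : ℝ) - c * ((n₁ + n₂ : ℤ) : ℝ)) ^ (-(3 / 2) : ℝ) +
    bracket ((n₂ : ℝ) - c * ((n₁ + n₂ : ℤ) : ℝ)) ^ (-(3 / 2) : ℝ)

/-- The kernel that controls the nonresonant frequencies. It is summable in `n₁` when `n₁ + n₂` is
held fixed. -/
noncomputable def nonresonantKernel (c : ℝ) (n₁ n₂ : ℤ) : ℝ :=
  resonantKernel c n₁ n₂ +
    (bracket (n₁ : ℝ) ^ (-(3 / 2) : ℝ) + bracket (n₂ : ℝ) ^ (-(3 / 2) : ℝ))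

lemma resonantKernel_nonneg (c : ℝ) (n₁ n₂ : ℤ) : 0 ≤ resonantKernel c n₁ n₂ :=
  add_nonneg (Real.rpow_nonneg (bracket_pos _).le _) (Real.rpow_nonneg (bracket_pos _).le _)

lemma nonresonantKernel_nonneg (c : ℝ) (n₁ n₂ : ℤ) : 0 ≤ nonresonantKernel c n₁ n₂ :=
  add_nonneg (resonantKernel_nonneg _ _ _)
    (add_nonneg (Real.rpow_nonneg (bracket_pos _).le _) (Real.rpow_nonneg (bracket_pos _).le _))

lemma resonantKernel_le_nonresonantKernel (c : ℝ) (n₁ n₂ : ℤ) :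
    resonantKernel c n₁ n₂ ≤ nonresonantKernel c n₁ n₂ :=
  le_add_of_nonneg_right
    (add_nonneg (Real.rpow_nonneg (bracket_pos _).le _) (Real.rpow_nonneg (bracket_pos _).le _))

lemma bracket_neg (x : ℝ) : bracket (-x) = bracket x := by simp [bracket]

lemma exists_tsum_nonresonantKernel_le (c : ℝ) :
    ∃ C : ℝ, 0 ≤ C ∧ ∀ n : ℤ,
      ∑' k : ℤ, ENNReal.ofReal (nonresonantKernel c k (n - k)) ≤ ENNReal.ofReal C := by
  obtain ⟨C, hC, h⟩ := exists_tsum_bracket_le one_ne_zero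
  refine ⟨(C + C) + (C + C), by positivity, fun n => ?_⟩
  have hb : ∀ x : ℝ, 0 ≤ bracket x ^ (-(3 / 2) : ℝ) :=
    fun x => Real.rpow_nonneg (bracket_pos _).le _
  rw [ENNReal.ofReal_add (by positivity) (by positivity), ENNReal.ofReal_add hC hC]
  simp only [nonresonantKernel, resonantKernel]
  simp_rw [ENNReal.ofReal_add (add_nonneg (hb _) (hb _)) (add_nonneg (hb _) (hb _)),
    ENNReal.ofReal_add (hb _) (hb _)]
  rw [ENNReal.tsum_add, ENNReal.tsum_add, ENNReal.tsum_add]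
  refine add_le_add (add_le_add ?_ ?_) (add_le_add ?_ ?_)
  · refine (ENNReal.tsum_le_tsum fun k => le_of_eq ?_).trans (h (c * n))
    congr 3; push_cast; ring
  · refine (ENNReal.tsum_le_tsum fun k => le_of_eq ?_).trans (h (n - c * n))
    rw [← bracket_neg]
    congr 3; push_cast; ring
  · refine (ENNReal.tsum_le_tsum fun k => le_of_eq ?_).trans (h 0)
    congr 3; ring
  · refine (ENNReal.tsum_le_tsum fun k => le_of_eq ?_).trans (h n)
    rw [← bracket_neg]
    congr 3; push_cast; ring

lemma exists_tsum_resonantKernel_le {c : ℝ} (hc0 : c ≠ 0) (hc1 : c ≠ 1) :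
    ∃ C : ℝ, 0 ≤ C ∧ ∀ l : ℤ,
      ∑' n : ℤ, ENNReal.ofReal (resonantKernel c (n - l) l) ≤ ENNReal.ofReal C := by
  obtain ⟨C, hC, h⟩ := exists_tsum_bracket_le (sub_ne_zero.2 hc1.symm)
  obtain ⟨C', hC', h'⟩ := exists_tsum_bracket_le hc0
  refine ⟨C + C', by positivity, fun l => ?_⟩
  have hb : ∀ x : ℝ, 0 ≤ bracket x ^ (-(3 / 2) : ℝ) :=
    fun x => Real.rpow_nonneg (bracket_pos _).le _
  rw [ENNReal.ofReal_add hC hC']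
  simp only [resonantKernel]
  simp_rw [ENNReal.ofReal_add (hb _) (hb _)]
  rw [ENNReal.tsum_add]
  refine add_le_add ?_ ?_
  · refine (ENNReal.tsum_le_tsum fun k => le_of_eq ?_).trans (h l)
    congr 3; push_cast; ring
  · refine (ENNReal.tsum_le_tsum fun k => le_of_eq ?_).trans (h' l)
    rw [← bracket_neg]
    congr 3; push_cast; ring

lemma mul_bracket_le_of_abs_sub_le {μ e n x : ℝ} (hμ1 : μ ≤ 1) (hμe : μ ≤ |e|)
    (h : |x - e * n| ≤ 1) : μ * bracket n ≤ 2 * bracket x := by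
  have h1 : |e * n| ≤ |x| + 1 := by
    have h2 := abs_sub_abs_le_abs_sub (e * n) x
    rw [abs_sub_comm] at h2
    linarith
  rw [abs_mul] at h1
  have h3 : μ * |n| ≤ |e| * |n| := mul_le_mul_of_nonneg_right hμe (abs_nonneg _)
  unfold bracket
  have := abs_nonneg x
  nlinarith

lemma rpow_bracket_le_of_mul_le {D x y s : ℝ} (hD : 0 < D) (h : D * bracket x ≤ 2 * bracket y)
    (hs : 0 ≤ s) : bracket x ^ s ≤ (2 / D) ^ s * bracket y ^ s := by
  rw [← Real.mul_rpow (by positivity) (bracket_pos _).le]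
  refine Real.rpow_le_rpow (bracket_pos _).le ?_ hs
  rw [div_mul_eq_mul_div, le_div_iff₀ hD]
  linarith

/-- The kernel bound at resonant frequencies: the Diophantine condition gains `|n|^((1 - ν) / 2)`
there, and both input frequencies are comparable to `n`, so that the missing power of `n` is
absorbed by the weight with exponent `s₂`. -/
lemma exists_resonant_bound {α ν s₁ s₂ : ℝ} (h0 : 0 < α) (h4 : α < 4) (h1 : α ≠ 1)
    (hν : IsOfType (c₁ α) ν) (hν0 : 0 < ν) (hs₁ : 0 ≤ s₁) (hs₂ : 1 / 2 + ν / 2 ≤ s₂) :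
    ∃ C : ℝ, 0 ≤ C ∧ ∀ n₁ n₂ : ℤ, n₁ + n₂ ≠ 0 →
      min |(n₁ : ℝ) - c₁ α * ((n₁ + n₂ : ℤ) : ℝ)| |(n₂ : ℝ) - c₁ α * ((n₁ + n₂ : ℤ) : ℝ)| ≤ 1 →
      |((n₁ + n₂ : ℤ) : ℝ)| * bracket ((n₁ + n₂ : ℤ) : ℝ) ^ s₁ *
          bracket (resonance α n₁ n₂) ^ (-(1 / 2) : ℝ) ≤
        C * (resonantKernel (c₁ α) n₁ n₂ * (bracket (n₁ : ℝ) ^ s₂ * bracket (n₂ : ℝ) ^ s₁)) := by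
  obtain ⟨κ, hκ, hR⟩ := abs_resonance_ge_rpow h0 h4 hν
  have hc := half_lt_c₁ h0 h4
  have hc1 := c₁_ne_one h0 h4 h1
  set c := c₁ α with hc_def
  set μ : ℝ := min 1 (min |c| |1 - c|) with hμ
  have hμ0 : 0 < μ := lt_min one_pos
    (lt_min (abs_pos.2 (by linarith)) (abs_pos.2 (sub_ne_zero.2 hc1.symm)))
  have hμ1 : μ ≤ 1 := min_le_left _ _
  have hμ2 : μ ≤ |c| := (min_le_right _ _).trans (min_le_left _ _)
  have hμ3 : μ ≤ |1 - c| := (min_le_right _ _).trans (min_le_right _ _)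
  have hs₂0 : 0 ≤ s₂ := by linarith
  refine ⟨κ ^ (-(1 / 2) : ℝ) * (2 / μ) ^ s₂ * (2 / μ) ^ s₁ * 2 ^ (3 / 2 : ℝ),
    by positivity, fun n₁ n₂ hn hmin => ?_⟩
  have hRn := hR n₁ n₂ hn
  have hn' : ((n₁ + n₂ : ℤ) : ℝ) ≠ 0 := by exact_mod_cast hn
  have hsum : ((n₁ + n₂ : ℤ) : ℝ) = n₁ + n₂ := by push_cast; rfl
  unfold resonantKernel
  set n : ℝ := ((n₁ + n₂ : ℤ) : ℝ) with hn_def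
  have hpos : 0 < |n| := abs_pos.2 hn'
  have hbr : ∀ x : ℝ, 0 ≤ bracket x ^ (-(3 / 2) : ℝ) :=
    fun x => Real.rpow_nonneg (bracket_pos _).le _
  -- The kernel is bounded below where one of its two brackets is at most `2`.
  have hk : ∀ x : ℝ, |x| ≤ 1 → (2 : ℝ) ^ (-(3 / 2) : ℝ) ≤ bracket x ^ (-(3 / 2) : ℝ) := by
    intro x hx
    refine Real.rpow_le_rpow_of_nonpos (bracket_pos x) ?_ (by norm_num)
    unfold bracket; linarith
  have hcomp : μ * bracket n ≤ 2 * bracket n₁ ∧ μ * bracket n ≤ 2 * bracket n₂ ∧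
      (2 : ℝ) ^ (-(3 / 2) : ℝ) ≤ bracket ((n₁ : ℝ) - c * n) ^ (-(3 / 2) : ℝ) +
        bracket ((n₂ : ℝ) - c * n) ^ (-(3 / 2) : ℝ) := by
    rcases min_le_iff.1 hmin with h | h
    · refine ⟨mul_bracket_le_of_abs_sub_le hμ1 hμ2 h, mul_bracket_le_of_abs_sub_le hμ1 hμ3 ?_, ?_⟩
      · rwa [show (n₂ : ℝ) - (1 - c) * n = -((n₁ : ℝ) - c * n) by rw [hsum]; ring, abs_neg]
      · linarith [hk _ h, hbr ((n₂ : ℝ) - c * n)]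
    · refine ⟨mul_bracket_le_of_abs_sub_le hμ1 hμ3 ?_, mul_bracket_le_of_abs_sub_le hμ1 hμ2 h, ?_⟩
      · rwa [show (n₁ : ℝ) - (1 - c) * n = -((n₂ : ℝ) - c * n) by rw [hsum]; ring, abs_neg]
      · linarith [hk _ h, hbr ((n₁ : ℝ) - c * n)]
  obtain ⟨hc₁, hc₂, hker⟩ := hcomp
  have hR' : bracket (resonance α n₁ n₂) ^ (-(1 / 2) : ℝ) ≤
      κ ^ (-(1 / 2) : ℝ) * |n| ^ (-(1 / 2) + ν / 2) := by
    have : |n| ^ (-(1 / 2) + ν / 2) = (|n| ^ (1 - ν)) ^ (-(1 / 2) : ℝ) := by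
      rw [← Real.rpow_mul hpos.le]
      congr 1; ring
    rw [this, ← Real.mul_rpow hκ.le (by positivity)]
    refine Real.rpow_le_rpow_of_nonpos (by positivity) (hRn.trans ?_) (by norm_num)
    unfold bracket; linarith
  have hgain : |n| * bracket (resonance α n₁ n₂) ^ (-(1 / 2) : ℝ) ≤
      κ ^ (-(1 / 2) : ℝ) * bracket n ^ s₂ := by
    calc |n| * bracket (resonance α n₁ n₂) ^ (-(1 / 2) : ℝ)
        ≤ |n| * (κ ^ (-(1 / 2) : ℝ) * |n| ^ (-(1 / 2) + ν / 2)) := by gcongr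
      _ = κ ^ (-(1 / 2) : ℝ) * |n| ^ (1 / 2 + ν / 2) := by
          rw [show 1 / 2 + ν / 2 = 1 + (-(1 / 2) + ν / 2) by ring, Real.rpow_add hpos 1,
            Real.rpow_one]
          ring
      _ ≤ κ ^ (-(1 / 2) : ℝ) * bracket n ^ (1 / 2 + ν / 2) := by
          gcongr
          unfold bracket; linarith
      _ ≤ κ ^ (-(1 / 2) : ℝ) * bracket n ^ s₂ := by
          gcongr
          exact one_le_bracket n
  have hp₁ := rpow_bracket_le_of_mul_le hμ0 hc₁ hs₂0
  have hp₂ := rpow_bracket_le_of_mul_le hμ0 hc₂ hs₁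
  have hB : ∀ (x s : ℝ), 0 ≤ bracket x ^ s := fun x s => Real.rpow_nonneg (bracket_pos _).le _
  have h2 : (2 : ℝ) ^ (3 / 2 : ℝ) * 2 ^ (-(3 / 2) : ℝ) = 1 := by
    rw [← Real.rpow_add (by norm_num)]; norm_num
  calc |n| * bracket n ^ s₁ * bracket (resonance α n₁ n₂) ^ (-(1 / 2) : ℝ)
      = (|n| * bracket (resonance α n₁ n₂) ^ (-(1 / 2) : ℝ)) * bracket n ^ s₁ := by ring
    _ ≤ (κ ^ (-(1 / 2) : ℝ) * ((2 / μ) ^ s₂ * bracket (n₁ : ℝ) ^ s₂)) *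
        ((2 / μ) ^ s₁ * bracket (n₂ : ℝ) ^ s₁) := by
        refine mul_le_mul (hgain.trans ?_) hp₂ (hB _ _)
          (mul_nonneg (by positivity) (mul_nonneg (by positivity) (hB _ _)))
        gcongr
    _ = κ ^ (-(1 / 2) : ℝ) * (2 / μ) ^ s₂ * (2 / μ) ^ s₁ * 2 ^ (3 / 2 : ℝ) *
        (2 ^ (-(3 / 2) : ℝ) * (bracket (n₁ : ℝ) ^ s₂ * bracket (n₂ : ℝ) ^ s₁)) := by
        linear_combination (-(κ ^ (-(1 / 2) : ℝ) * ((2 / μ) ^ s₂ * bracket (n₁ : ℝ) ^ s₂) *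
          ((2 / μ) ^ s₁ * bracket (n₂ : ℝ) ^ s₁))) * h2
    _ ≤ _ := by
        have := mul_nonneg (hB (n₁ : ℝ) s₂) (hB (n₂ : ℝ) s₁)
        gcongr

lemma inv_mul_rpow_le_add {a x : ℝ} (ha : 0 < a) (hx : 0 < x) :
    a⁻¹ * x ^ (-(1 / 2) : ℝ) ≤ a ^ (-(3 / 2) : ℝ) + x ^ (-(3 / 2) : ℝ) := by
  have ha' : a ^ (-(3 / 2) : ℝ) = a⁻¹ * a ^ (-(1 / 2) : ℝ) := by
    rw [← Real.rpow_neg_one, ← Real.rpow_add ha]; norm_num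
  have hx' : x ^ (-(3 / 2) : ℝ) = x⁻¹ * x ^ (-(1 / 2) : ℝ) := by
    rw [← Real.rpow_neg_one, ← Real.rpow_add hx]; norm_num
  have h1 : 0 ≤ a ^ (-(1 / 2) : ℝ) := by positivity
  have h2 : 0 ≤ x ^ (-(1 / 2) : ℝ) := by positivity
  rcases le_total a x with h | h
  · have : x ^ (-(1 / 2) : ℝ) ≤ a ^ (-(1 / 2) : ℝ) :=
      Real.rpow_le_rpow_of_nonpos ha h (by norm_num)
    have h3 : a⁻¹ * x ^ (-(1 / 2) : ℝ) ≤ a⁻¹ * a ^ (-(1 / 2) : ℝ) := by gcongr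
    rw [ha']
    have : 0 ≤ x ^ (-(3 / 2) : ℝ) := by positivity
    linarith
  · have h3 : a⁻¹ * x ^ (-(1 / 2) : ℝ) ≤ x⁻¹ * x ^ (-(1 / 2) : ℝ) := by gcongr
    rw [hx']
    have : 0 ≤ a ^ (-(3 / 2) : ℝ) := by positivity
    linarith

/-- With `s ≥ 1 / 4`, the squared product of the weights at the two input frequencies dominates the
squared weight at their sum, with at least a half power of the smaller input frequency to spare. -/
lemma bracket_add_rpow_le {s : ℝ} (hs : 1 / 4 ≤ s) (x y : ℝ) :
    bracket (x + y) ^ (2 * s) ≤ 2 ^ (2 * s) * (bracket x ^ s * bracket y ^ s) ^ 2 *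
      bracket x ^ (-(1 / 2) : ℝ) ∨
    bracket (x + y) ^ (2 * s) ≤ 2 ^ (2 * s) * (bracket x ^ s * bracket y ^ s) ^ 2 *
      bracket y ^ (-(1 / 2) : ℝ) := by
  have key : ∀ a b : ℝ, 1 ≤ a → a ≤ b → (2 * b) ^ (2 * s) ≤
      2 ^ (2 * s) * (a ^ s * b ^ s) ^ 2 * a ^ (-(1 / 2) : ℝ) := by
    intro a b ha hab
    have ha0 : 0 < a := by linarith
    have hb0 : 0 < b := by linarith
    have e : ∀ z : ℝ, 0 < z → (z ^ s) ^ 2 = z ^ (2 * s) := by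
      intro z hz
      rw [← Real.rpow_natCast, ← Real.rpow_mul hz.le]
      congr 1; push_cast; ring
    rw [Real.mul_rpow (by norm_num) hb0.le, mul_pow, e a ha0, e b hb0, mul_assoc, mul_assoc,
      mul_comm (b ^ _), ← mul_assoc (a ^ _), ← Real.rpow_add ha0]
    have : 1 ≤ a ^ (2 * s + -(1 / 2)) := Real.one_le_rpow ha (by linarith)
    have hb : 0 ≤ b ^ (2 * s) := by positivity
    gcongr
    nlinarith
  have hxy : bracket (x + y) ≤ bracket x + bracket y := by
    unfold bracket
    linarith [abs_add_le x y]
  rcases le_total (bracket x) (bracket y) with h | h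
  · left
    refine le_trans ?_ (key _ _ (one_le_bracket x) h)
    exact Real.rpow_le_rpow (bracket_pos _).le (by linarith) (by linarith)
  · right
    rw [mul_comm (bracket x ^ s)]
    refine le_trans ?_ (key _ _ (one_le_bracket y) h)
    exact Real.rpow_le_rpow (bracket_pos _).le (by linarith) (by linarith)

/-- The kernel bound at nonresonant frequencies, where the resonance function is at least of size
`n²` times the smaller of its two other factors. -/
lemma exists_nonresonant_bound {α s : ℝ} (h0 : 0 < α) (h4 : α < 4) (hs : 1 / 4 ≤ s) :
    ∃ C : ℝ, 0 ≤ C ∧ ∀ n₁ n₂ : ℤ,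
      1 ≤ min |(n₁ : ℝ) - c₁ α * ((n₁ + n₂ : ℤ) : ℝ)| |(n₂ : ℝ) - c₁ α * ((n₁ + n₂ : ℤ) : ℝ)| →
      |((n₁ + n₂ : ℤ) : ℝ)| * bracket ((n₁ + n₂ : ℤ) : ℝ) ^ s *
          bracket (resonance α n₁ n₂) ^ (-(1 / 2) : ℝ) ≤
        C * (Real.sqrt (nonresonantKernel (c₁ α) n₁ n₂) *
          (bracket (n₁ : ℝ) ^ s * bracket (n₂ : ℝ) ^ s)) := by
  have hc := half_lt_c₁ h0 h4
  set δ : ℝ := 3 * α * (c₁ α - 1 / 2) with hδ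
  have hδ0 : 0 < δ := mul_pos (by positivity) (by linarith)
  refine ⟨Real.sqrt (δ⁻¹ * 2 * 2 ^ (2 * s)), Real.sqrt_nonneg _, fun n₁ n₂ hm => ?_⟩
  have hR := abs_resonance_ge h0 h4 n₁ n₂
  have hN := bracket_add_rpow_le hs n₁ n₂
  have hsum : ((n₁ + n₂ : ℤ) : ℝ) = n₁ + n₂ := by push_cast; rfl
  rw [← hsum] at hN
  unfold nonresonantKernel resonantKernel
  set n : ℝ := ((n₁ + n₂ : ℤ) : ℝ) with hn_def
  set a : ℝ := (n₁ : ℝ) - c₁ α * n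
  set b : ℝ := (n₂ : ℝ) - c₁ α * n
  set m : ℝ := min |a| |b| with hm_def
  set W : ℝ := bracket (n₁ : ℝ) ^ s * bracket (n₂ : ℝ) ^ s with hW
  have hB : ∀ (x s : ℝ), 0 ≤ bracket x ^ s := fun x s => Real.rpow_nonneg (bracket_pos _).le _
  have hW0 : 0 ≤ W := mul_nonneg (hB _ _) (hB _ _)
  set k : ℝ := bracket a ^ (-(3 / 2) : ℝ) + bracket b ^ (-(3 / 2) : ℝ) +
    (bracket (n₁ : ℝ) ^ (-(3 / 2) : ℝ) + bracket (n₂ : ℝ) ^ (-(3 / 2) : ℝ)) with hk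
  have hk0 : 0 ≤ k := add_nonneg (add_nonneg (hB _ _) (hB _ _)) (add_nonneg (hB _ _) (hB _ _))
  have hm0 : 0 < m := by linarith
  -- As `m ≥ 1`, it is comparable to the bracket of one of the two factors.
  have hm' : m⁻¹ ≤ 2 * (bracket a)⁻¹ ∨ m⁻¹ ≤ 2 * (bracket b)⁻¹ := by
    have key : ∀ x : ℝ, 1 ≤ |x| → |x|⁻¹ ≤ 2 * (bracket x)⁻¹ := by
      intro x hx
      have hbx := bracket_pos x
      rw [← div_eq_mul_inv, le_div_iff₀ hbx, inv_mul_le_iff₀ (by linarith)]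
      unfold bracket; linarith
    rcases min_choice |a| |b| with h | h
    · left; rw [hm_def, h]; exact key _ (h ▸ hm)
    · right; rw [hm_def, h]; exact key _ (h ▸ hm)
  have hprod : bracket n ^ (2 * s) * m⁻¹ ≤ 2 * 2 ^ (2 * s) * W ^ 2 * k := by
    have key : ∀ z x : ℝ, bracket n ^ (2 * s) ≤ 2 ^ (2 * s) * W ^ 2 * bracket x ^ (-(1 / 2) : ℝ) →
        m⁻¹ ≤ 2 * (bracket z)⁻¹ → bracket z ^ (-(3 / 2) : ℝ) + bracket x ^ (-(3 / 2) : ℝ) ≤ k →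
        bracket n ^ (2 * s) * m⁻¹ ≤ 2 * 2 ^ (2 * s) * W ^ 2 * k := by
      intro z x h1 h2 h3
      calc bracket n ^ (2 * s) * m⁻¹
          ≤ (2 ^ (2 * s) * W ^ 2 * bracket x ^ (-(1 / 2) : ℝ)) * (2 * (bracket z)⁻¹) :=
            mul_le_mul h1 h2 (by positivity)
              (mul_nonneg (by positivity) (hB _ _))
        _ = 2 * 2 ^ (2 * s) * W ^ 2 * ((bracket z)⁻¹ * bracket x ^ (-(1 / 2) : ℝ)) := by ring
        _ ≤ _ := by
            gcongr
            exact (inv_mul_rpow_le_add (bracket_pos z) (bracket_pos x)).trans h3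
    have e1 := hB a (-(3 / 2))
    have e2 := hB b (-(3 / 2))
    have e3 := hB n₁ (-(3 / 2))
    have e4 := hB n₂ (-(3 / 2))
    rcases hN with h1 | h1 <;> rcases hm' with h2 | h2 <;>
      exact key _ _ h1 h2 (by rw [hk]; linarith)
  have hRpos := bracket_pos (resonance α n₁ n₂)
  have hgain : n ^ 2 * (bracket (resonance α n₁ n₂))⁻¹ ≤ δ⁻¹ * m⁻¹ := by
    rw [← div_eq_mul_inv, ← mul_inv, div_le_iff₀ hRpos, ← div_eq_inv_mul,
      le_div_iff₀ (by positivity)]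
    rw [sq_abs] at hR
    calc n ^ 2 * (δ * m) = δ * n ^ 2 * m := by ring
      _ ≤ |resonance α n₁ n₂| := hR
      _ ≤ _ := by unfold bracket; linarith
  refine abs_le_of_sq_le_sq' ?_ (by positivity) |>.2
  rw [mul_pow, mul_pow, mul_pow, mul_pow, Real.sq_sqrt (by positivity), Real.sq_sqrt hk0, sq_abs]
  have e1 : (bracket n ^ s) ^ 2 = bracket n ^ (2 * s) := by
    rw [← Real.rpow_natCast, ← Real.rpow_mul (bracket_pos _).le]
    congr 1; push_cast; ring
  have e2 : (bracket (resonance α n₁ n₂) ^ (-(1 / 2) : ℝ)) ^ 2 =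
      (bracket (resonance α n₁ n₂))⁻¹ := by
    rw [← Real.rpow_natCast, ← Real.rpow_mul hRpos.le, ← Real.rpow_neg_one]
    congr 1; push_cast; ring
  rw [e1, e2]
  calc n ^ 2 * bracket n ^ (2 * s) * (bracket (resonance α n₁ n₂))⁻¹
      = (n ^ 2 * (bracket (resonance α n₁ n₂))⁻¹) * bracket n ^ (2 * s) := by ring
    _ ≤ (δ⁻¹ * m⁻¹) * bracket n ^ (2 * s) := by
        gcongr
        exact hB _ _
    _ = δ⁻¹ * (bracket n ^ (2 * s) * m⁻¹) := by ring
    _ ≤ δ⁻¹ * (2 * 2 ^ (2 * s) * W ^ 2 * k) := by gcongr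
    _ = _ := by ring

/-- The kernel bound at all frequencies. Both sides are nonnegative, and the left one vanishes at
`n₁ + n₂ = 0`. -/
lemma exists_kernel_bound {α ν s₁ s₂ : ℝ} (h0 : 0 < α) (h4 : α < 4) (h1 : α ≠ 1)
    (hν : IsOfType (c₁ α) ν) (hν0 : 0 < ν) (hs₁ : 1 / 4 ≤ s₁) (hs₂ : 1 / 2 + ν / 2 ≤ s₂) :
    ∃ C : ℝ, 0 ≤ C ∧ ∀ n₁ n₂ : ℤ,
      |((n₁ + n₂ : ℤ) : ℝ)| * bracket ((n₁ + n₂ : ℤ) : ℝ) ^ s₁ *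
          bracket (resonance α n₁ n₂) ^ (-(1 / 2) : ℝ) ≤
        C * (resonantKernel (c₁ α) n₁ n₂ * (bracket (n₁ : ℝ) ^ s₂ * bracket (n₂ : ℝ) ^ s₁) +
          Real.sqrt (nonresonantKernel (c₁ α) n₁ n₂) *
            (bracket (n₁ : ℝ) ^ s₁ * bracket (n₂ : ℝ) ^ s₁)) := by
  obtain ⟨C, hC, h⟩ := exists_resonant_bound h0 h4 h1 hν hν0 (by linarith : 0 ≤ s₁) hs₂
  obtain ⟨C', hC', h'⟩ := exists_nonresonant_bound h0 h4 hs₁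
  have hB : ∀ (x s : ℝ), 0 ≤ bracket x ^ s := fun x s => Real.rpow_nonneg (bracket_pos _).le _
  refine ⟨C + C', by positivity, fun n₁ n₂ => ?_⟩
  have e1 := mul_nonneg (resonantKernel_nonneg (c₁ α) n₁ n₂)
    (mul_nonneg (hB n₁ s₂) (hB n₂ s₁))
  have e2 := mul_nonneg (Real.sqrt_nonneg (nonresonantKernel (c₁ α) n₁ n₂))
    (mul_nonneg (hB n₁ s₁) (hB n₂ s₁))
  by_cases hn : n₁ + n₂ = 0
  · simp only [hn, Int.cast_zero, abs_zero, zero_mul]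
    positivity
  rcases le_total (min |(n₁ : ℝ) - c₁ α * ((n₁ + n₂ : ℤ) : ℝ)|
    |(n₂ : ℝ) - c₁ α * ((n₁ + n₂ : ℤ) : ℝ)|) 1 with hm | hm
  · refine (h n₁ n₂ hn hm).trans ?_
    nlinarith [mul_nonneg hC e2, mul_nonneg hC' e1, mul_nonneg hC' e2]
  · refine (h' n₁ n₂ hm).trans ?_
    nlinarith [mul_nonneg hC e2, mul_nonneg hC e1, mul_nonneg hC' e1]

/-! ### The bilinear estimate for sequences -/

lemma sq_rpow_half (a : ℝ≥0∞) : (a ^ (1 / 2 : ℝ)) ^ 2 = a := by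
  rw [← ENNReal.rpow_two, ← ENNReal.rpow_mul]; norm_num

lemma sq_lintegral_mul_le {X : Type*} [MeasurableSpace X] {μ : Measure X} {f g : X → ℝ≥0∞}
    (hf : AEMeasurable f μ) (hg : AEMeasurable g μ) :
    (∫⁻ x, f x * g x ∂μ) ^ 2 ≤ (∫⁻ x, f x ^ 2 ∂μ) * ∫⁻ x, g x ^ 2 ∂μ := by
  have h := ENNReal.lintegral_mul_le_Lp_mul_Lq μ Real.HolderConjugate.two_two hf hg
  simp only [Pi.mul_apply, ENNReal.rpow_two] at h
  calc (∫⁻ x, f x * g x ∂μ) ^ 2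
      ≤ ((∫⁻ x, f x ^ 2 ∂μ) ^ (1 / 2 : ℝ) * (∫⁻ x, g x ^ 2 ∂μ) ^ (1 / 2 : ℝ)) ^ 2 := by gcongr
    _ = _ := by
        rw [mul_pow, ← ENNReal.rpow_two, ← ENNReal.rpow_two, ← ENNReal.rpow_mul,
          ← ENNReal.rpow_mul]
        norm_num

lemma sq_tsum_mul_le (f g : ℤ → ℝ≥0∞) :
    (∑' n, f n * g n) ^ 2 ≤ (∑' n, f n ^ 2) * ∑' n, g n ^ 2 := by
  simp only [← lintegral_count]
  exact sq_lintegral_mul_le (measurable_of_countable f).aemeasurable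
    (measurable_of_countable g).aemeasurable

lemma add_sq_le_two_mul (a b : ℝ≥0∞) : (a + b) ^ 2 ≤ 2 * (a ^ 2 + b ^ 2) := by
  have h := ENNReal.rpow_add_le_mul_rpow_add_rpow a b (one_le_two : (1 : ℝ) ≤ 2)
  simpa [ENNReal.rpow_two, show (2 : ℝ) - 1 = 1 by norm_num] using h

/-- A form of Schur's test: the kernel `A` is summable in `k` for fixed output `n`, and in `n` for
fixed input `l = n - k`. -/
lemma tsum_sq_tsum_mul_le {A : ℤ → ℤ → ℝ≥0∞} {C D : ℝ≥0∞}
    (hC : ∀ n, ∑' k, A k (n - k) ≤ C) (hD : ∀ l, ∑' n, A (n - l) l ≤ D) (r : ℤ → ℝ≥0∞) :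
    ∑' n, (∑' k, A k (n - k) * r (n - k)) ^ 2 ≤ C * D * ∑' l, r l ^ 2 := by
  calc ∑' n, (∑' k, A k (n - k) * r (n - k)) ^ 2
      ≤ ∑' n, C * ∑' k, A k (n - k) * r (n - k) ^ 2 := by
        refine ENNReal.tsum_le_tsum fun n => ?_
        have h := sq_tsum_mul_le (fun k => A k (n - k) ^ (1 / 2 : ℝ))
          (fun k => A k (n - k) ^ (1 / 2 : ℝ) * r (n - k))
        simp only [mul_pow, ← mul_assoc, ← sq, sq_rpow_half] at h
        exact h.trans (mul_le_mul_left (hC n) _)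
    _ = C * ∑' n, ∑' l, A (n - l) l * r l ^ 2 := by
        rw [ENNReal.tsum_mul_left]
        congr 2
        ext n
        rw [← (Equiv.subLeft n).tsum_eq]
        simp
    _ = C * ∑' l, (∑' n, A (n - l) l) * r l ^ 2 := by
        rw [ENNReal.tsum_comm]
        simp_rw [ENNReal.tsum_mul_right]
    _ ≤ C * ∑' l, D * r l ^ 2 := by
        gcongr with l
        exact hD l
    _ = _ := by rw [ENNReal.tsum_mul_left, mul_assoc]

lemma tsum_mul_convolution (f g : ℤ → ℝ≥0∞) :
    ∑' n, ∑' k, f k * g (n - k) = (∑' k, f k) * ∑' k, g k := by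
  rw [ENNReal.tsum_comm, ← ENNReal.tsum_mul_right]
  refine tsum_congr fun k => ?_
  rw [ENNReal.tsum_mul_left]
  congr 1
  exact (Equiv.subRight k).tsum_eq g

lemma tsum_sq_tsum_kernel_mul_le {B : ℤ → ℤ → ℝ≥0∞} {C : ℝ≥0∞}
    (hC : ∀ n, ∑' k, B k (n - k) ^ 2 ≤ C) (x y : ℤ → ℝ≥0∞) :
    ∑' n, (∑' k, B k (n - k) * (x k * y (n - k))) ^ 2 ≤
      C * ((∑' l, x l ^ 2) * ∑' l, y l ^ 2) := by
  calc ∑' n, (∑' k, B k (n - k) * (x k * y (n - k))) ^ 2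
      ≤ ∑' n, C * ∑' k, x k ^ 2 * y (n - k) ^ 2 := by
        refine ENNReal.tsum_le_tsum fun n => ?_
        have h := sq_tsum_mul_le (fun k => B k (n - k)) (fun k => x k * y (n - k))
        simp only [mul_pow] at h
        exact h.trans (mul_le_mul_left (hC n) _)
    _ = _ := by
        rw [ENNReal.tsum_mul_left, tsum_mul_convolution (fun k => x k ^ 2) (fun k => y k ^ 2)]

/-- The weight that the bilinear estimate puts on the interaction of the frequencies `n₁`, `n₂`. -/
noncomputable def interactionWeight (α s : ℝ) (n₁ n₂ : ℤ) : ℝ :=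
  |((n₁ + n₂ : ℤ) : ℝ)| * bracket ((n₁ + n₂ : ℤ) : ℝ) ^ s *
    bracket (resonance α n₁ n₂) ^ (-(1 / 2) : ℝ)

/-- The norm of `ℓ² ∩ ℓ^∞` with weights `⟨n⟩^{s₁}` and `⟨n⟩^{s₂}` respectively. -/
noncomputable def sequenceNorm (s₁ s₂ : ℝ) (p : ℤ → ℝ≥0∞) : ℝ≥0∞ :=
  (∑' n : ℤ, (ENNReal.ofReal (bracket (n : ℝ) ^ s₁) * p n) ^ 2) ^ (1 / 2 : ℝ) +
    ⨆ n : ℤ, ENNReal.ofReal (bracket (n : ℝ) ^ s₂) * p n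

/-- The bilinear estimate for sequences. Schur's test handles the resonant part, with the first
sequence in `ℓ^∞`, and the Cauchy-Schwarz inequality handles the nonresonant part, with both
sequences in `ℓ²`. -/
lemma exists_sequence_bound {α ν s₁ s₂ : ℝ} (h0 : 0 < α) (h4 : α < 4) (h1 : α ≠ 1)
    (hν : IsOfType (c₁ α) ν) (hν0 : 0 < ν) (hs₁ : 1 / 4 ≤ s₁) (hs₂ : 1 / 2 + ν / 2 ≤ s₂) :
    ∃ C : ℝ≥0∞, C ≠ ⊤ ∧ ∀ p q : ℤ → ℝ≥0∞,
      (∑' n : ℤ, (∑' k : ℤ, ENNReal.ofReal (interactionWeight α s₁ k (n - k)) *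
          (p k * q (n - k))) ^ 2) ^ (1 / 2 : ℝ) ≤
        C * (sequenceNorm s₁ s₂ p * sequenceNorm s₁ s₂ q) := by
  obtain ⟨C, hC, h⟩ := exists_kernel_bound h0 h4 h1 hν hν0 hs₁ hs₂
  obtain ⟨D, hD, hB⟩ := exists_tsum_nonresonantKernel_le (c₁ α)
  obtain ⟨E, hE, hA⟩ := exists_tsum_resonantKernel_le
    (by linarith [half_lt_c₁ h0 h4] : c₁ α ≠ 0) (c₁_ne_one h0 h4 h1)
  set S : ℝ≥0∞ := ENNReal.ofReal C ^ 2 * (2 * (ENNReal.ofReal D * ENNReal.ofReal E +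
    ENNReal.ofReal D)) with hS
  refine ⟨S ^ (1 / 2 : ℝ), by
    refine ENNReal.rpow_ne_top_of_nonneg (by norm_num) ?_
    simp [hS, ENNReal.mul_eq_top], fun p q => ?_⟩
  set x₁ : ℤ → ℝ≥0∞ := fun n => ENNReal.ofReal (bracket (n : ℝ) ^ s₁) * p n
  set x₂ : ℤ → ℝ≥0∞ := fun n => ENNReal.ofReal (bracket (n : ℝ) ^ s₂) * p n
  set y : ℤ → ℝ≥0∞ := fun n => ENNReal.ofReal (bracket (n : ℝ) ^ s₁) * q n
  set A : ℤ → ℤ → ℝ≥0∞ := fun k l => ENNReal.ofReal (resonantKernel (c₁ α) k l)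
  set B : ℤ → ℤ → ℝ≥0∞ := fun k l => ENNReal.ofReal (Real.sqrt (nonresonantKernel (c₁ α) k l))
  set P : ℝ≥0∞ := sequenceNorm s₁ s₂ p
  set Q : ℝ≥0∞ := sequenceNorm s₁ s₂ q
  have hx₁ : ∑' n, x₁ n ^ 2 ≤ P ^ 2 := by
    rw [← sq_rpow_half (∑' n, x₁ n ^ 2)]
    gcongr
    exact le_self_add
  have hy : ∑' n, y n ^ 2 ≤ Q ^ 2 := by
    rw [← sq_rpow_half (∑' n, y n ^ 2)]
    gcongr
    exact le_self_add
  have hx₂ : ∀ n, x₂ n ≤ P := fun n => (le_iSup x₂ n).trans le_add_self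
  have hbr : ∀ (x s : ℝ), 0 ≤ bracket x ^ s := fun x s => Real.rpow_nonneg (bracket_pos _).le _
  have hpt : ∀ k l : ℤ, ENNReal.ofReal (interactionWeight α s₁ k l) * (p k * q l) ≤
      ENNReal.ofReal C * (P * (A k l * y l) + B k l * (x₁ k * y l)) := by
    intro k l
    calc ENNReal.ofReal (interactionWeight α s₁ k l) * (p k * q l)
        ≤ ENNReal.ofReal (C * (resonantKernel (c₁ α) k l *
            (bracket (k : ℝ) ^ s₂ * bracket (l : ℝ) ^ s₁) +
          Real.sqrt (nonresonantKernel (c₁ α) k l) *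
            (bracket (k : ℝ) ^ s₁ * bracket (l : ℝ) ^ s₁))) * (p k * q l) := by
          gcongr
          exact h k l
      _ = ENNReal.ofReal C * (x₂ k * (A k l * y l) + B k l * (x₁ k * y l)) := by
          rw [ENNReal.ofReal_mul hC, ENNReal.ofReal_add
            (mul_nonneg (resonantKernel_nonneg _ _ _) (mul_nonneg (hbr _ _) (hbr _ _)))
            (mul_nonneg (Real.sqrt_nonneg _) (mul_nonneg (hbr _ _) (hbr _ _))),
            ENNReal.ofReal_mul (resonantKernel_nonneg _ _ _), ENNReal.ofReal_mul (hbr _ _),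
            ENNReal.ofReal_mul (Real.sqrt_nonneg _), ENNReal.ofReal_mul (hbr _ _)]
          simp only [x₁, x₂, y, A, B]
          ring
      _ ≤ _ := by
          gcongr
          exact hx₂ k
  have hBsq : ∀ n, ∑' k, B k (n - k) ^ 2 ≤ ENNReal.ofReal D := by
    intro n
    refine le_trans (le_of_eq ?_) (hB n)
    refine tsum_congr fun k => ?_
    simp only [B]
    rw [← ENNReal.ofReal_pow (Real.sqrt_nonneg _), Real.sq_sqrt (nonresonantKernel_nonneg _ _ _)]
  have hAD : ∀ n, ∑' k, A k (n - k) ≤ ENNReal.ofReal D := fun n =>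
    (ENNReal.tsum_le_tsum fun k => ENNReal.ofReal_le_ofReal
      (resonantKernel_le_nonresonantKernel _ _ _)).trans (hB n)
  have hmain : ∑' n : ℤ, (∑' k : ℤ, ENNReal.ofReal (interactionWeight α s₁ k (n - k)) *
      (p k * q (n - k))) ^ 2 ≤ S * (P * Q) ^ 2 := by
    calc ∑' n : ℤ, (∑' k : ℤ, ENNReal.ofReal (interactionWeight α s₁ k (n - k)) *
          (p k * q (n - k))) ^ 2
        ≤ ∑' n : ℤ, (ENNReal.ofReal C ^ 2 * (2 * (P ^ 2 * (∑' k, A k (n - k) * y (n - k)) ^ 2 +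
            (∑' k, B k (n - k) * (x₁ k * y (n - k))) ^ 2))) := by
          refine ENNReal.tsum_le_tsum fun n => ?_
          calc (∑' k : ℤ, ENNReal.ofReal (interactionWeight α s₁ k (n - k)) *
                (p k * q (n - k))) ^ 2
              ≤ (∑' k, ENNReal.ofReal C * (P * (A k (n - k) * y (n - k)) +
                  B k (n - k) * (x₁ k * y (n - k)))) ^ 2 := by
                exact pow_le_pow_left' (ENNReal.tsum_le_tsum fun k => hpt k (n - k)) 2
            _ = ENNReal.ofReal C ^ 2 * (P * ∑' k, A k (n - k) * y (n - k) +
                  ∑' k, B k (n - k) * (x₁ k * y (n - k))) ^ 2 := by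
                rw [ENNReal.tsum_mul_left, ENNReal.tsum_add, ENNReal.tsum_mul_left, mul_pow]
            _ ≤ _ := by
                gcongr
                refine (add_sq_le_two_mul _ _).trans_eq ?_
                rw [mul_pow]
      _ = ENNReal.ofReal C ^ 2 * (2 * (P ^ 2 * ∑' n, (∑' k, A k (n - k) * y (n - k)) ^ 2 +
            ∑' n, (∑' k, B k (n - k) * (x₁ k * y (n - k))) ^ 2)) := by
          rw [ENNReal.tsum_mul_left, ENNReal.tsum_mul_left, ENNReal.tsum_add,
            ENNReal.tsum_mul_left]
      _ ≤ ENNReal.ofReal C ^ 2 * (2 * (P ^ 2 * (ENNReal.ofReal D * ENNReal.ofReal E * Q ^ 2) +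
            ENNReal.ofReal D * (P ^ 2 * Q ^ 2))) := by
          gcongr
          · exact (tsum_sq_tsum_mul_le hAD hA y).trans (by gcongr)
          · exact (tsum_sq_tsum_kernel_mul_le hBsq x₁ y).trans (by gcongr)
      _ = S * (P * Q) ^ 2 := by rw [hS]; ring
  calc _ ≤ (S * (P * Q) ^ 2) ^ (1 / 2 : ℝ) := by gcongr
    _ = S ^ (1 / 2 : ℝ) * (P * Q) := by
        rw [ENNReal.mul_rpow_of_nonneg _ _ (by norm_num), ← ENNReal.rpow_two ,
          ← ENNReal.rpow_mul]
        norm_num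

/-! ### Convolution estimates in the time frequency -/

lemma rpow_half_le_iff {a b : ℝ≥0∞} : a ^ (1 / 2 : ℝ) ≤ b ↔ a ≤ b ^ 2 := by
  constructor
  · intro h
    rw [← sq_rpow_half a]
    gcongr
  · intro h
    calc a ^ (1 / 2 : ℝ) ≤ (b ^ 2) ^ (1 / 2 : ℝ) := by gcongr
      _ = b := by
        rw [← ENNReal.rpow_two, ← ENNReal.rpow_mul]; norm_num

/-- The triangle inequality in `L²` for countable sums of nonnegative functions. -/
lemma lintegral_sq_tsum_le {X : Type*} [MeasurableSpace X] {μ : Measure X} {h : ℤ → X → ℝ≥0∞}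
    (hh : ∀ k, Measurable (h k)) :
    ∫⁻ x, (∑' k, h k x) ^ 2 ∂μ ≤ (∑' k, (∫⁻ x, h k x ^ 2 ∂μ) ^ (1 / 2 : ℝ)) ^ 2 := by
  calc ∫⁻ x, (∑' k, h k x) ^ 2 ∂μ = ∫⁻ x, ∑' k, ∑' l, h k x * h l x ∂μ := by
        simp_rw [sq, ← ENNReal.tsum_mul_right, ← ENNReal.tsum_mul_left]
    _ = ∑' k, ∑' l, ∫⁻ x, h k x * h l x ∂μ := by
        have hm : ∀ k l, Measurable fun x => h k x * h l x := fun k l => (hh k).mul (hh l)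
        rw [lintegral_tsum fun k => (Measurable.tsum fun l => hm k l).aemeasurable]
        exact tsum_congr fun k => lintegral_tsum fun l => (hm k l).aemeasurable
    _ ≤ ∑' k, ∑' l, (∫⁻ x, h k x ^ 2 ∂μ) ^ (1 / 2 : ℝ) * (∫⁻ x, h l x ^ 2 ∂μ) ^ (1 / 2 : ℝ) := by
        refine ENNReal.tsum_le_tsum fun k => ENNReal.tsum_le_tsum fun l => ?_
        have := ENNReal.lintegral_mul_le_Lp_mul_Lq μ Real.HolderConjugate.two_two
          (hh k).aemeasurable (hh l).aemeasurable
        simpa only [Pi.mul_apply, ENNReal.rpow_two] using this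
    _ = _ := by
        simp_rw [ENNReal.tsum_mul_left, ENNReal.tsum_mul_right, sq]

/-- The convolution of nonnegative functions on the line. -/
noncomputable def lconv (f g : ℝ → ℝ≥0∞) (τ : ℝ) : ℝ≥0∞ := ∫⁻ σ, f σ * g (τ - σ)

lemma measurable_lconv {f g : ℝ → ℝ≥0∞} (hf : Measurable f) (hg : Measurable g) :
    Measurable (lconv f g) := by
  unfold lconv
  have h : Measurable fun p : ℝ × ℝ => f p.2 * g (p.1 - p.2) := by fun_prop
  exact h.lintegral_prod_right'

lemma lconv_comm (f g : ℝ → ℝ≥0∞) : lconv f g = lconv g f := by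
  ext τ
  unfold lconv
  rw [← lintegral_sub_left_eq_self _ τ]
  simp [mul_comm]

lemma lintegral_lconv {f g : ℝ → ℝ≥0∞} (hf : Measurable f) (hg : Measurable g) :
    ∫⁻ τ, lconv f g τ = (∫⁻ σ, f σ) * ∫⁻ σ, g σ := by
  unfold lconv
  rw [lintegral_lintegral_swap (by fun_prop)]
  rw [← lintegral_mul_const _ hf]
  refine lintegral_congr fun σ => ?_
  rw [lintegral_const_mul _ (by fun_prop), lintegral_sub_right_eq_self]

/-- Young's inequality `L¹ * L² ⊆ L²`. -/
lemma lintegral_lconv_sq_le {f g : ℝ → ℝ≥0∞} (hf : Measurable f) (hg : Measurable g) :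
    ∫⁻ τ, lconv f g τ ^ 2 ≤ (∫⁻ σ, f σ) ^ 2 * ∫⁻ σ, g σ ^ 2 := by
  calc ∫⁻ τ, lconv f g τ ^ 2
      ≤ ∫⁻ τ, (∫⁻ σ, f σ) * lconv f (fun σ => g σ ^ 2) τ := by
        refine lintegral_mono fun τ => ?_
        have h := sq_lintegral_mul_le (μ := volume) (f := fun σ => f σ ^ (1 / 2 : ℝ))
          (g := fun σ => f σ ^ (1 / 2 : ℝ) * g (τ - σ)) (by fun_prop) (by fun_prop)
        simp only [mul_pow, ← mul_assoc, ← sq, sq_rpow_half] at h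
        exact h
    _ = _ := by
        rw [lintegral_const_mul _ (measurable_lconv hf (by fun_prop)),
          lintegral_lconv hf (by fun_prop), sq, mul_assoc]

lemma measurable_bracket : Measurable bracket := by
  unfold bracket
  fun_prop

lemma bracket_sub_rpow_half_le (a a₁ a₂ τ σ : ℝ) :
    bracket (a - a₁ - a₂) ^ (1 / 2 : ℝ) ≤ bracket (τ - a) ^ (1 / 2 : ℝ) +
      bracket (σ - a₁) ^ (1 / 2 : ℝ) + bracket (τ - σ - a₂) ^ (1 / 2 : ℝ) := by
  have h : bracket (a - a₁ - a₂) ≤ bracket (τ - a) + bracket (σ - a₁) + bracket (τ - σ - a₂) := by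
    have e : a - a₁ - a₂ = -(τ - a) + (σ - a₁) + (τ - σ - a₂) := by ring
    unfold bracket
    rw [e]
    have h1 := abs_add_three (-(τ - a)) (σ - a₁) (τ - σ - a₂)
    rw [abs_neg] at h1
    linarith
  have h1 := (bracket_pos (τ - a)).le
  have h2 := (bracket_pos (σ - a₁)).le
  have h3 := (bracket_pos (τ - σ - a₂)).le
  refine (Real.rpow_le_rpow (bracket_pos _).le h (by norm_num)).trans ?_
  refine (Real.rpow_add_le_add_rpow (by positivity) h3 (by norm_num) (by norm_num)).trans ?_
  gcongr
  exact Real.rpow_add_le_add_rpow h1 h2 (by norm_num) (by norm_num)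

lemma lintegral_bracket_inv_sq_ne_top :
    ∫⁻ τ : ℝ, ENNReal.ofReal (bracket τ ^ (-1 : ℝ)) ^ 2 ≠ ⊤ := by
  have h : Integrable fun τ : ℝ => (1 + ‖τ‖) ^ (-(2 : ℝ)) :=
    integrable_one_add_norm (by simp)
  have := h.lintegral_lt_top.ne
  convert this using 3 with τ
  have hb := bracket_pos τ
  rw [← ENNReal.ofReal_pow (by positivity), ← Real.rpow_natCast, ← Real.rpow_mul hb.le]
  unfold bracket
  norm_num

/-- The `L¹` norm plus the `L²` norm with weight `⟨τ - a⟩^{1/2}`. -/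
noncomputable def modulationNorm (a : ℝ) (f : ℝ → ℝ≥0∞) : ℝ≥0∞ :=
  (∫⁻ τ, f τ) + (∫⁻ τ, (ENNReal.ofReal (bracket (τ - a) ^ (1 / 2 : ℝ)) * f τ) ^ 2) ^ (1 / 2 : ℝ)

/-- A convolution gains the power `-1 / 2` of the bracket of the resonance `a - a₁ - a₂`, at the
cost of a half power of the modulation of one of the factors, or of the output. -/
lemma lconv_le (a a₁ a₂ : ℝ) {f g : ℝ → ℝ≥0∞} (hf : Measurable f) (hg : Measurable g) (τ : ℝ) :
    lconv f g τ ≤ ENNReal.ofReal (bracket (a - a₁ - a₂) ^ (-(1 / 2) : ℝ)) *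
      (ENNReal.ofReal (bracket (τ - a) ^ (1 / 2 : ℝ)) * lconv f g τ +
        lconv (fun σ => ENNReal.ofReal (bracket (σ - a₁) ^ (1 / 2 : ℝ)) * f σ) g τ +
        lconv f (fun σ => ENNReal.ofReal (bracket (σ - a₂) ^ (1 / 2 : ℝ)) * g σ) τ) := by
  have hmb := measurable_bracket
  have hb : ∀ x s : ℝ, 0 ≤ bracket x ^ s := fun x s => Real.rpow_nonneg (bracket_pos _).le _
  unfold lconv
  -- With everything under one integral sign it suffices to compare the integrands.
  rw [← lintegral_const_mul _ (by fun_prop), ← lintegral_add_left (by fun_prop),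
    ← lintegral_add_left (by fun_prop), ← lintegral_const_mul _ (by fun_prop)]
  refine lintegral_mono fun σ => ?_
  have h := bracket_sub_rpow_half_le a a₁ a₂ τ σ
  have hR := bracket_pos (a - a₁ - a₂)
  have h1 : 1 ≤ bracket (a - a₁ - a₂) ^ (-(1 / 2) : ℝ) * (bracket (τ - a) ^ (1 / 2 : ℝ) +
      bracket (σ - a₁) ^ (1 / 2 : ℝ) + bracket (τ - σ - a₂) ^ (1 / 2 : ℝ)) := by
    rw [Real.rpow_neg hR.le, ← div_eq_inv_mul, one_le_div (by positivity)]
    exact h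
  have h2 := ENNReal.ofReal_le_ofReal h1
  rw [ENNReal.ofReal_one, ENNReal.ofReal_mul (hb _ _),
    ENNReal.ofReal_add (add_nonneg (hb _ _) (hb _ _)) (hb _ _),
    ENNReal.ofReal_add (hb _ _) (hb _ _)] at h2
  calc f σ * g (τ - σ) = 1 * (f σ * g (τ - σ)) := by rw [one_mul]
    _ ≤ _ := mul_le_mul_left h2 _
    _ = _ := by ring

lemma ofReal_bracket_rpow_le_one (x : ℝ) {s : ℝ} (hs : s ≤ 0) :
    ENNReal.ofReal (bracket x ^ s) ≤ 1 := by
  rw [← ENNReal.ofReal_one]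
  exact ENNReal.ofReal_le_ofReal (Real.rpow_le_one_of_one_le_of_nonpos (one_le_bracket x) hs)

lemma ofReal_bracket_rpow_mul (x s t : ℝ) :
    ENNReal.ofReal (bracket x ^ s) * ENNReal.ofReal (bracket x ^ t) =
      ENNReal.ofReal (bracket x ^ (s + t)) := by
  rw [← ENNReal.ofReal_mul (Real.rpow_nonneg (bracket_pos _).le _), Real.rpow_add (bracket_pos _)]

lemma one_le_ofReal_bracket_rpow (x : ℝ) {s : ℝ} (hs : 0 ≤ s) :
    1 ≤ ENNReal.ofReal (bracket x ^ s) := by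
  rw [← ENNReal.ofReal_one]
  exact ENNReal.ofReal_le_ofReal (Real.one_le_rpow (one_le_bracket x) hs)

/-- The `L²` part of the modulation estimate for the interaction of two spatial modes. -/
lemma lintegral_weighted_lconv_sq_le (a a₁ a₂ : ℝ) {f g : ℝ → ℝ≥0∞} (hf : Measurable f)
    (hg : Measurable g) :
    (∫⁻ τ, (ENNReal.ofReal (bracket (τ - a) ^ (-(1 / 2) : ℝ)) * lconv f g τ) ^ 2) ^ (1 / 2 : ℝ) ≤
      ENNReal.ofReal (bracket (a - a₁ - a₂) ^ (-(1 / 2) : ℝ)) *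
        (4 * (modulationNorm a₁ f * modulationNorm a₂ g)) := by
  have hmb := measurable_bracket
  set ρ := ENNReal.ofReal (bracket (a - a₁ - a₂) ^ (-(1 / 2) : ℝ))
  set F : ℝ → ℝ≥0∞ := fun σ => ENNReal.ofReal (bracket (σ - a₁) ^ (1 / 2 : ℝ)) * f σ with hF
  set G : ℝ → ℝ≥0∞ := fun σ => ENNReal.ofReal (bracket (σ - a₂) ^ (1 / 2 : ℝ)) * g σ with hG
  have hFm : Measurable F := by fun_prop
  have hGm : Measurable G := by fun_prop
  set p := modulationNorm a₁ f
  set q := modulationNorm a₂ g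
  have hf1 : ∫⁻ σ, f σ ≤ p := le_self_add
  have hg1 : ∫⁻ σ, g σ ≤ q := le_self_add
  have hF2 : ∫⁻ σ, F σ ^ 2 ≤ p ^ 2 := rpow_half_le_iff.1 le_add_self
  have hG2 : ∫⁻ σ, G σ ^ 2 ≤ q ^ 2 := rpow_half_le_iff.1 le_add_self
  have hg2 : ∫⁻ σ, g σ ^ 2 ≤ q ^ 2 := by
    refine le_trans (lintegral_mono fun σ => ?_) hG2
    gcongr
    exact le_mul_of_one_le_left' (one_le_ofReal_bracket_rpow _ (by norm_num))
  have hm1 := measurable_lconv hf hg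
  have hm2 := measurable_lconv hFm hg
  have hm3 := measurable_lconv hf hGm
  rw [rpow_half_le_iff]
  calc ∫⁻ τ, (ENNReal.ofReal (bracket (τ - a) ^ (-(1 / 2) : ℝ)) * lconv f g τ) ^ 2
      ≤ ∫⁻ τ, ρ ^ 2 * (4 * (lconv f g τ ^ 2 + lconv F g τ ^ 2 + lconv f G τ ^ 2)) := by
        refine lintegral_mono fun τ => ?_
        set w := ENNReal.ofReal (bracket (τ - a) ^ (-(1 / 2) : ℝ)) with hw
        have hw1 : w ≤ 1 := ofReal_bracket_rpow_le_one _ (by norm_num)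
        have hww : w * ENNReal.ofReal (bracket (τ - a) ^ (1 / 2 : ℝ)) = 1 := by
          rw [hw, ofReal_bracket_rpow_mul]; norm_num
        calc (w * lconv f g τ) ^ 2
            ≤ (w * (ρ * (ENNReal.ofReal (bracket (τ - a) ^ (1 / 2 : ℝ)) * lconv f g τ +
                lconv F g τ + lconv f G τ))) ^ 2 := by
              gcongr
              exact lconv_le a a₁ a₂ hf hg τ
          _ = ρ ^ 2 * ((w * ENNReal.ofReal (bracket (τ - a) ^ (1 / 2 : ℝ))) * lconv f g τ +
                w * (lconv F g τ + lconv f G τ)) ^ 2 := by ring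
          _ ≤ ρ ^ 2 * (lconv f g τ + (lconv F g τ + lconv f G τ)) ^ 2 := by
              rw [hww, one_mul]
              gcongr
              exact mul_le_of_le_one_left' hw1
          _ ≤ ρ ^ 2 * (2 * (lconv f g τ ^ 2 + 2 * (lconv F g τ ^ 2 + lconv f G τ ^ 2))) := by
              gcongr
              refine (add_sq_le_two_mul _ _).trans ?_
              gcongr
              exact add_sq_le_two_mul _ _
          _ ≤ ρ ^ 2 * (2 * (2 * lconv f g τ ^ 2 + 2 * (lconv F g τ ^ 2 + lconv f G τ ^ 2))) := by
              gcongr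
              exact le_mul_of_one_le_left' one_le_two
          _ = _ := by ring
    _ = ρ ^ 2 * (4 * ((∫⁻ τ, lconv f g τ ^ 2) + (∫⁻ τ, lconv F g τ ^ 2) +
          ∫⁻ τ, lconv f G τ ^ 2)) := by
        rw [lintegral_const_mul _ (by fun_prop), lintegral_const_mul _ (by fun_prop),
          lintegral_add_left (by fun_prop), lintegral_add_left (by fun_prop)]
    _ ≤ ρ ^ 2 * (4 * (p ^ 2 * q ^ 2 + q ^ 2 * p ^ 2 + p ^ 2 * q ^ 2)) := by
        gcongr
        · exact (lintegral_lconv_sq_le hf hg).trans (by gcongr)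
        · rw [lconv_comm]
          exact (lintegral_lconv_sq_le hg hFm).trans (by gcongr)
        · exact (lintegral_lconv_sq_le hf hGm).trans (by gcongr)
    _ = 12 * (ρ * (p * q)) ^ 2 := by ring
    _ ≤ 16 * (ρ * (p * q)) ^ 2 := by gcongr; norm_num
    _ = _ := by ring

/-- The `L¹` part of the modulation estimate for the interaction of two spatial modes. -/
lemma lintegral_weighted_lconv_le (a a₁ a₂ : ℝ) {f g : ℝ → ℝ≥0∞} (hf : Measurable f)
    (hg : Measurable g) :
    ∫⁻ τ, ENNReal.ofReal (bracket (τ - a) ^ (-1 : ℝ)) * lconv f g τ ≤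
      ENNReal.ofReal (bracket (a - a₁ - a₂) ^ (-(1 / 2) : ℝ)) *
        ((1 + 2 * (∫⁻ τ : ℝ, ENNReal.ofReal (bracket τ ^ (-1 : ℝ)) ^ 2) ^ (1 / 2 : ℝ)) *
          (modulationNorm a₁ f * modulationNorm a₂ g)) := by
  have hmb := measurable_bracket
  set J := ∫⁻ τ : ℝ, ENNReal.ofReal (bracket τ ^ (-1 : ℝ)) ^ 2 with hJ
  set ρ := ENNReal.ofReal (bracket (a - a₁ - a₂) ^ (-(1 / 2) : ℝ))
  set F : ℝ → ℝ≥0∞ := fun σ => ENNReal.ofReal (bracket (σ - a₁) ^ (1 / 2 : ℝ)) * f σ with hF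
  set G : ℝ → ℝ≥0∞ := fun σ => ENNReal.ofReal (bracket (σ - a₂) ^ (1 / 2 : ℝ)) * g σ with hG
  have hFm : Measurable F := by fun_prop
  have hGm : Measurable G := by fun_prop
  set p := modulationNorm a₁ f
  set q := modulationNorm a₂ g
  have hf1 : ∫⁻ σ, f σ ≤ p := le_self_add
  have hg1 : ∫⁻ σ, g σ ≤ q := le_self_add
  have hF2 : ∫⁻ σ, F σ ^ 2 ≤ p ^ 2 := rpow_half_le_iff.1 le_add_self
  have hG2 : ∫⁻ σ, G σ ^ 2 ≤ q ^ 2 := rpow_half_le_iff.1 le_add_self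
  have hm1 := measurable_lconv hf hg
  have hm2 := measurable_lconv hFm hg
  have hm3 := measurable_lconv hf hGm
  -- The weight `⟨τ - a⟩⁻¹` is square integrable, so it maps `L²` to `L¹`.
  have hCS : ∀ h : ℝ → ℝ≥0∞, Measurable h → ∫⁻ τ, h τ ^ 2 ≤ (p * q) ^ 2 →
      ∫⁻ τ, ENNReal.ofReal (bracket (τ - a) ^ (-1 : ℝ)) * h τ ≤ J ^ (1 / 2 : ℝ) * (p * q) := by
    intro h hh hle
    have h1 := sq_lintegral_mul_le (μ := volume)
      (f := fun τ => ENNReal.ofReal (bracket (τ - a) ^ (-1 : ℝ))) (by fun_prop) hh.aemeasurable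
    rw [lintegral_sub_right_eq_self (fun τ => ENNReal.ofReal (bracket τ ^ (-1 : ℝ)) ^ 2),
      ← hJ] at h1
    rw [← ENNReal.pow_le_pow_left_iff two_ne_zero, mul_pow, sq_rpow_half]
    exact h1.trans (by gcongr)
  calc ∫⁻ τ, ENNReal.ofReal (bracket (τ - a) ^ (-1 : ℝ)) * lconv f g τ
      ≤ ∫⁻ τ, ρ * (lconv f g τ + (ENNReal.ofReal (bracket (τ - a) ^ (-1 : ℝ)) * lconv F g τ +
          ENNReal.ofReal (bracket (τ - a) ^ (-1 : ℝ)) * lconv f G τ)) := by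
        refine lintegral_mono fun τ => ?_
        set w := ENNReal.ofReal (bracket (τ - a) ^ (-1 : ℝ)) with hw
        have hww : w * ENNReal.ofReal (bracket (τ - a) ^ (1 / 2 : ℝ)) ≤ 1 := by
          rw [hw, ofReal_bracket_rpow_mul]
          exact ofReal_bracket_rpow_le_one _ (by norm_num)
        calc w * lconv f g τ
            ≤ w * (ρ * (ENNReal.ofReal (bracket (τ - a) ^ (1 / 2 : ℝ)) * lconv f g τ +
                lconv F g τ + lconv f G τ)) := by
              gcongr
              exact lconv_le a a₁ a₂ hf hg τ
          _ = ρ * ((w * ENNReal.ofReal (bracket (τ - a) ^ (1 / 2 : ℝ))) * lconv f g τ +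
                (w * lconv F g τ + w * lconv f G τ)) := by ring
          _ ≤ _ := by
              gcongr
              exact mul_le_of_le_one_left' hww
    _ = ρ * ((∫⁻ τ, lconv f g τ) +
          ((∫⁻ τ, ENNReal.ofReal (bracket (τ - a) ^ (-1 : ℝ)) * lconv F g τ) +
          ∫⁻ τ, ENNReal.ofReal (bracket (τ - a) ^ (-1 : ℝ)) * lconv f G τ)) := by
        rw [lintegral_const_mul _ (by fun_prop), lintegral_add_left (by fun_prop),
          lintegral_add_left (by fun_prop)]
    _ ≤ ρ * (p * q + (J ^ (1 / 2 : ℝ) * (p * q) + J ^ (1 / 2 : ℝ) * (p * q))) := by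
        gcongr
        · rw [lintegral_lconv hf hg]
          gcongr
        · refine hCS _ hm2 ?_
          rw [lconv_comm, mul_comm p, mul_pow]
          exact (lintegral_lconv_sq_le hg hFm).trans (by gcongr)
        · refine hCS _ hm3 ?_
          rw [mul_pow]
          exact (lintegral_lconv_sq_le hf hGm).trans (by gcongr)
    _ = _ := by ring

/-! ### The bilinear estimate on the Fourier side -/

lemma weighted_eq (α s b : ℝ) (F : ℤ → ℝ → ℂ) (n : ℤ) (τ : ℝ) :
    weighted α s b F n τ = ENNReal.ofReal (bracket (n : ℝ) ^ s) *
      (ENNReal.ofReal (bracket (τ - α * (n : ℝ) ^ 3) ^ b) * ‖F n τ‖ₑ) := by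
  rw [weighted, ENNReal.ofReal_mul (Real.rpow_nonneg (bracket_pos _).le _), mul_assoc]

lemma lintegral_weighted_zero (α s : ℝ) {F : ℤ → ℝ → ℂ} {n : ℤ} (hF : Measurable (F n)) :
    ∫⁻ τ, weighted α s 0 F n τ = ENNReal.ofReal (bracket (n : ℝ) ^ s) * ∫⁻ τ, ‖F n τ‖ₑ := by
  simp_rw [weighted_eq, Real.rpow_zero, ENNReal.ofReal_one, one_mul]
  exact lintegral_const_mul _ (by fun_prop)

lemma lintegral_weighted_sq (α s b : ℝ) {F : ℤ → ℝ → ℂ} {n : ℤ} (hF : Measurable (F n)) :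
    ∫⁻ τ, weighted α s b F n τ ^ 2 = ENNReal.ofReal (bracket (n : ℝ) ^ s) ^ 2 *
      ∫⁻ τ, (ENNReal.ofReal (bracket (τ - α * (n : ℝ) ^ 3) ^ b) * ‖F n τ‖ₑ) ^ 2 := by
  have hmb := measurable_bracket
  simp_rw [weighted_eq, mul_pow _ (_ * _)]
  exact lintegral_const_mul _ (by fun_prop)

/-- The `Y` norm controls the sequence of the modulation norms of the spatial modes. -/
lemma sequenceNorm_modulationNorm_le (α s₁ s₂ : ℝ) {F : ℤ → ℝ → ℂ} (hF : ∀ n, Measurable (F n)) :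
    sequenceNorm s₁ s₂ (fun n => modulationNorm (α * (n : ℝ) ^ 3) fun τ => ‖F n τ‖ₑ) ≤
      2 * hatNormY α s₁ s₂ F := by
  set A : ℤ → ℝ≥0∞ := fun n => ∫⁻ τ, ‖F n τ‖ₑ with hA
  set B : ℤ → ℝ≥0∞ := fun n =>
    (∫⁻ τ, (ENNReal.ofReal (bracket (τ - α * (n : ℝ) ^ 3) ^ (1 / 2 : ℝ)) * ‖F n τ‖ₑ) ^ 2) ^
      (1 / 2 : ℝ) with hB
  have h22 : normL2L2 (weighted α s₁ (1 / 2) F) =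
      (∑' n : ℤ, (ENNReal.ofReal (bracket (n : ℝ) ^ s₁) * B n) ^ 2) ^ (1 / 2 : ℝ) := by
    unfold normL2L2
    simp_rw [lintegral_weighted_sq _ _ _ (hF _), hB, mul_pow _ (_ ^ (1 / 2 : ℝ)), sq_rpow_half]
  have h21 : normL2L1 (weighted α s₁ 0 F) =
      (∑' n : ℤ, (ENNReal.ofReal (bracket (n : ℝ) ^ s₁) * A n) ^ 2) ^ (1 / 2 : ℝ) := by
    unfold normL2L1
    simp_rw [lintegral_weighted_zero _ _ (hF _), hA]
  have hi2 : normLinfL2 (weighted α s₂ (1 / 2) F) =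
      ⨆ n : ℤ, ENNReal.ofReal (bracket (n : ℝ) ^ s₂) * B n := by
    unfold normLinfL2
    refine iSup_congr fun n => ?_
    rw [lintegral_weighted_sq _ _ _ (hF _), ENNReal.mul_rpow_of_nonneg _ _ (by norm_num),
      ← ENNReal.rpow_two, ← ENNReal.rpow_mul]
    norm_num [hB]
  have hi1 : normLinfL1 (weighted α s₂ 0 F) =
      ⨆ n : ℤ, ENNReal.ofReal (bracket (n : ℝ) ^ s₂) * A n := by
    unfold normLinfL1
    simp_rw [lintegral_weighted_zero _ _ (hF _), hA]
  unfold hatNormY sequenceNorm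
  rw [h22, h21, hi2, hi1, mul_add]
  change (∑' n : ℤ, (ENNReal.ofReal (bracket (n : ℝ) ^ s₁) * (A n + B n)) ^ 2) ^ (1 / 2 : ℝ) +
    ⨆ n : ℤ, ENNReal.ofReal (bracket (n : ℝ) ^ s₂) * (A n + B n) ≤ _
  simp_rw [mul_add (ENNReal.ofReal _) (A _)]
  refine add_le_add ?_ ?_
  · set x : ℤ → ℝ≥0∞ := fun n => ENNReal.ofReal (bracket (n : ℝ) ^ s₁) * A n
    set y : ℤ → ℝ≥0∞ := fun n => ENNReal.ofReal (bracket (n : ℝ) ^ s₁) * B n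
    rw [rpow_half_le_iff]
    calc ∑' n, (x n + y n) ^ 2 ≤ ∑' n, 2 * (x n ^ 2 + y n ^ 2) :=
          ENNReal.tsum_le_tsum fun n => add_sq_le_two_mul _ _
      _ = 2 * (((∑' n, x n ^ 2) ^ (1 / 2 : ℝ)) ^ 2 + ((∑' n, y n ^ 2) ^ (1 / 2 : ℝ)) ^ 2) := by
          rw [ENNReal.tsum_mul_left, ENNReal.tsum_add, sq_rpow_half, sq_rpow_half]
      _ ≤ 4 * ((∑' n, y n ^ 2) ^ (1 / 2 : ℝ) + (∑' n, x n ^ 2) ^ (1 / 2 : ℝ)) ^ 2 := by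
          refine mul_le_mul' (by norm_num) ?_
          rw [add_sq, add_comm, add_right_comm]
          exact le_self_add
      _ = _ := by ring
  · calc ⨆ n : ℤ, (ENNReal.ofReal (bracket (n : ℝ) ^ s₂) * A n +
          ENNReal.ofReal (bracket (n : ℝ) ^ s₂) * B n)
        ≤ (⨆ n : ℤ, ENNReal.ofReal (bracket (n : ℝ) ^ s₂) * B n) +
          ⨆ n : ℤ, ENNReal.ofReal (bracket (n : ℝ) ^ s₂) * A n := by
          refine iSup_le fun n => ?_
          rw [add_comm]
          exact add_le_add (le_iSup (fun n : ℤ => ENNReal.ofReal (bracket (n : ℝ) ^ s₂) * B n) n)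
            (le_iSup (fun n : ℤ => ENNReal.ofReal (bracket (n : ℝ) ^ s₂) * A n) n)
      _ ≤ _ := le_mul_of_one_le_left' one_le_two

lemma sub_mul_cube_eq_resonance (α : ℝ) (n k : ℤ) :
    1 * (n : ℝ) ^ 3 - α * (k : ℝ) ^ 3 - α * ((n - k : ℤ) : ℝ) ^ 3 = resonance α k (n - k) := by
  unfold resonance
  push_cast
  ring

lemma ofReal_interactionWeight (α s : ℝ) (n k : ℤ) :
    ENNReal.ofReal (interactionWeight α s k (n - k)) = ENNReal.ofReal (bracket (n : ℝ) ^ s) *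
      ENNReal.ofReal |(n : ℝ)| * ENNReal.ofReal (bracket (resonance α k (n - k)) ^ (-(1 / 2) : ℝ)) := by
  have hbr : ∀ (x s : ℝ), 0 ≤ bracket x ^ s := fun x s => Real.rpow_nonneg (bracket_pos _).le _
  unfold interactionWeight
  rw [add_sub_cancel, ENNReal.ofReal_mul (mul_nonneg (abs_nonneg _) (hbr _ _)),
    ENNReal.ofReal_mul (abs_nonneg _), mul_comm (ENNReal.ofReal |(n : ℝ)|)]

/-- The bilinear estimate on the Fourier side. -/
lemma exists_hatNormZ_le {α ν s₁ s₂ : ℝ} (h0 : 0 < α) (h4 : α < 4) (h1 : α ≠ 1)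
    (hν : IsOfType (c₁ α) ν) (hν0 : 0 < ν) (hs₁ : 1 / 4 ≤ s₁) (hs₂ : 1 / 2 + ν / 2 ≤ s₂) :
    ∃ C : ℝ≥0∞, C ≠ ⊤ ∧ ∀ F₁ F₂ G : ℤ → ℝ → ℂ,
      (∀ n, Measurable (F₁ n)) → (∀ n, Measurable (F₂ n)) →
      (∀ n τ, ‖G n τ‖ₑ ≤ ENNReal.ofReal |(n : ℝ)| *
        ∑' k : ℤ, lconv (fun σ => ‖F₁ k σ‖ₑ) (fun σ => ‖F₂ (n - k) σ‖ₑ) τ) →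
      hatNormZ s₁ G ≤ C * (hatNormY α s₁ s₂ F₁ * hatNormY α s₁ s₂ F₂) := by
  obtain ⟨C, hC, h⟩ := exists_sequence_bound h0 h4 h1 hν hν0 hs₁ hs₂
  have hmb := measurable_bracket
  set J := ∫⁻ τ : ℝ, ENNReal.ofReal (bracket τ ^ (-1 : ℝ)) ^ 2 with hJ
  have hJtop : J ≠ ⊤ := lintegral_bracket_inv_sq_ne_top
  set E : ℝ≥0∞ := 1 + 2 * J ^ (1 / 2 : ℝ) with hE
  have hEtop : E ≠ ⊤ := by
    have := ENNReal.rpow_ne_top_of_nonneg (by norm_num : (0 : ℝ) ≤ 1 / 2) hJtop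
    finiteness
  refine ⟨(4 + E) * C * 4, by finiteness, fun F₁ F₂ G hF₁ hF₂ hG => ?_⟩
  set p : ℤ → ℝ≥0∞ := fun n => modulationNorm (α * (n : ℝ) ^ 3) fun τ => ‖F₁ n τ‖ₑ
  set q : ℤ → ℝ≥0∞ := fun n => modulationNorm (α * (n : ℝ) ^ 3) fun τ => ‖F₂ n τ‖ₑ
  set T : ℤ → ℝ≥0∞ := fun n => ∑' k : ℤ, ENNReal.ofReal (interactionWeight α s₁ k (n - k)) *
    (p k * q (n - k)) with hT
  set S : ℝ≥0∞ := (∑' n : ℤ, T n ^ 2) ^ (1 / 2 : ℝ) with hS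
  have hS_le : S ≤ C * ((2 * hatNormY α s₁ s₂ F₁) * (2 * hatNormY α s₁ s₂ F₂)) :=
    (h p q).trans (by
      gcongr
      · exact sequenceNorm_modulationNorm_le α s₁ s₂ hF₁
      · exact sequenceNorm_modulationNorm_le α s₁ s₂ hF₂)
  set c : ℤ → ℤ → ℝ → ℝ≥0∞ := fun n k => lconv (fun σ => ‖F₁ k σ‖ₑ) (fun σ => ‖F₂ (n - k) σ‖ₑ)
    with hc
  have hcm : ∀ n k, Measurable (c n k) := fun n k =>
    measurable_lconv (hF₁ k).enorm (hF₂ (n - k)).enorm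
  have hw : ∀ (b : ℝ) (n : ℤ) (τ : ℝ), weighted 1 s₁ b G n τ ≤
      ENNReal.ofReal (bracket (n : ℝ) ^ s₁) * ENNReal.ofReal |(n : ℝ)| *
        ∑' k, ENNReal.ofReal (bracket (τ - 1 * (n : ℝ) ^ 3) ^ b) * c n k τ := by
    intro b n τ
    rw [weighted_eq, ENNReal.tsum_mul_left, mul_assoc]
    refine mul_le_mul' le_rfl ?_
    rw [mul_left_comm]
    exact mul_le_mul' le_rfl (hG n τ)
  have h22 : normL2L2 (weighted 1 s₁ (-(1 / 2)) G) ≤ 4 * S := by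
    unfold normL2L2
    rw [rpow_half_le_iff, mul_pow, hS, sq_rpow_half, ← ENNReal.tsum_mul_left]
    refine ENNReal.tsum_le_tsum fun n => ?_
    set W := ENNReal.ofReal (bracket (n : ℝ) ^ s₁) * ENNReal.ofReal |(n : ℝ)|
    have hm : ∀ k, Measurable fun τ =>
        ENNReal.ofReal (bracket (τ - 1 * (n : ℝ) ^ 3) ^ (-(1 / 2) : ℝ)) * c n k τ := by
      intro k
      have := hcm n k
      fun_prop
    calc ∫⁻ τ, weighted 1 s₁ (-(1 / 2)) G n τ ^ 2
        ≤ ∫⁻ τ, W ^ 2 * (∑' k, ENNReal.ofReal (bracket (τ - 1 * (n : ℝ) ^ 3) ^ (-(1 / 2) : ℝ)) *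
            c n k τ) ^ 2 := by
          refine lintegral_mono fun τ => ?_
          rw [← mul_pow]
          exact pow_le_pow_left' (hw _ n τ) 2
      _ = W ^ 2 * ∫⁻ τ, (∑' k, ENNReal.ofReal
            (bracket (τ - 1 * (n : ℝ) ^ 3) ^ (-(1 / 2) : ℝ)) * c n k τ) ^ 2 :=
          lintegral_const_mul _ ((Measurable.tsum hm).pow_const 2)
      _ ≤ W ^ 2 * (∑' k, ENNReal.ofReal (bracket (resonance α k (n - k)) ^ (-(1 / 2) : ℝ)) *
            (4 * (p k * q (n - k)))) ^ 2 := by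
          gcongr
          refine (lintegral_sq_tsum_le hm).trans ?_
          refine pow_le_pow_left' (ENNReal.tsum_le_tsum fun k => ?_) 2
          rw [← sub_mul_cube_eq_resonance]
          exact lintegral_weighted_lconv_sq_le _ _ _ (hF₁ k).enorm (hF₂ (n - k)).enorm
      _ = (4 * T n) ^ 2 := by
          rw [← mul_pow, ← ENNReal.tsum_mul_left, hT, ← ENNReal.tsum_mul_left]
          congr 2
          ext k
          rw [ofReal_interactionWeight]
          ring
      _ = _ := mul_pow _ _ _
  have h21 : normL2L1 (weighted 1 s₁ (-1) G) ≤ E * S := by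
    unfold normL2L1
    rw [rpow_half_le_iff, mul_pow, hS, sq_rpow_half, ← ENNReal.tsum_mul_left]
    refine ENNReal.tsum_le_tsum fun n => ?_
    set W := ENNReal.ofReal (bracket (n : ℝ) ^ s₁) * ENNReal.ofReal |(n : ℝ)|
    have hm : ∀ k, Measurable fun τ =>
        ENNReal.ofReal (bracket (τ - 1 * (n : ℝ) ^ 3) ^ (-1 : ℝ)) * c n k τ := by
      intro k
      have := hcm n k
      fun_prop
    rw [← mul_pow]
    refine pow_le_pow_left' ?_ 2
    calc ∫⁻ τ, weighted 1 s₁ (-1) G n τ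
        ≤ ∫⁻ τ, W * ∑' k, ENNReal.ofReal (bracket (τ - 1 * (n : ℝ) ^ 3) ^ (-1 : ℝ)) *
            c n k τ := lintegral_mono fun τ => hw _ n τ
      _ = W * ∑' k, ∫⁻ τ, ENNReal.ofReal (bracket (τ - 1 * (n : ℝ) ^ 3) ^ (-1 : ℝ)) *
            c n k τ := by
          rw [lintegral_const_mul _ (Measurable.tsum hm), lintegral_tsum fun k => (hm k).aemeasurable]
      _ ≤ W * ∑' k, ENNReal.ofReal (bracket (resonance α k (n - k)) ^ (-(1 / 2) : ℝ)) *
            (E * (p k * q (n - k))) := by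
          gcongr with k
          rw [← sub_mul_cube_eq_resonance]
          exact lintegral_weighted_lconv_le _ _ _ (hF₁ k).enorm (hF₂ (n - k)).enorm
      _ = E * T n := by
          rw [← ENNReal.tsum_mul_left, hT, ← ENNReal.tsum_mul_left]
          congr 1
          ext k
          rw [ofReal_interactionWeight]
          ring
  calc hatNormZ s₁ G ≤ 4 * S + E * S := add_le_add h22 h21
    _ = (4 + E) * S := by ring
    _ ≤ (4 + E) * (C * ((2 * hatNormY α s₁ s₂ F₁) * (2 * hatNormY α s₁ s₂ F₂))) := by gcongr
    _ = _ := by ring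

/-! ### Fourier analysis in one variable -/

open scoped FourierTransform

/-- The Fourier transform in time of a Schwartz function, in the normalization of
`testFunction`. -/
noncomputable def timeFourier (ψ : 𝓢(ℝ, ℂ)) (t : ℝ) : ℂ :=
  ∫ τ : ℝ, ψ τ * Complex.exp (-(Complex.I * τ * t))

/-- The inverse Fourier transform in time, without the factor `1 / 2π`. -/
noncomputable def timeFourierInv (f : ℝ → ℂ) (t : ℝ) : ℂ :=
  ∫ τ : ℝ, f τ * Complex.exp (Complex.I * τ * t)

lemma timeFourier_eq (ψ : 𝓢(ℝ, ℂ)) (t : ℝ) : timeFourier ψ t = 𝓕 ψ ((2 * Real.pi)⁻¹ * t) := by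
  rw [SchwartzMap.fourier_coe, Real.fourier_real_eq_integral_exp_smul, timeFourier]
  refine integral_congr_ae (.of_forall fun τ => ?_)
  have hπ : (Real.pi : ℂ) ≠ 0 := by exact_mod_cast Real.pi_ne_zero
  simp only [smul_eq_mul]
  rw [mul_comm]
  congr 2
  push_cast
  field_simp

/-- Multiplication by a nonzero real number. -/
noncomputable def scaling (c : ℝ) (hc : c ≠ 0) : ℝ ≃L[ℝ] ℝ :=
  ContinuousLinearEquiv.unitsEquivAut ℝ (Units.mk0 c hc)

lemma scaling_apply (c : ℝ) (hc : c ≠ 0) (x : ℝ) : scaling c hc x = c * x := by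
  simp [scaling, mul_comm]

lemma exists_schwartz_eq_timeFourier (ψ : 𝓢(ℝ, ℂ)) : ∃ φ : 𝓢(ℝ, ℂ), ∀ t, timeFourier ψ t = φ t := by
  refine ⟨SchwartzMap.compCLMOfContinuousLinearEquiv ℂ
    (scaling (2 * Real.pi)⁻¹ (by positivity)) (𝓕 ψ), fun t => ?_⟩
  rw [timeFourier_eq, SchwartzMap.compCLMOfContinuousLinearEquiv_apply, Function.comp_apply,
    scaling_apply]

lemma exists_timeFourier_eq (φ : 𝓢(ℝ, ℂ)) : ∃ ψ : 𝓢(ℝ, ℂ), ∀ t, timeFourier ψ t = φ t := by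
  have hπ : (2 * Real.pi) ≠ 0 := by positivity
  refine ⟨𝓕⁻ (SchwartzMap.compCLMOfContinuousLinearEquiv ℂ (scaling (2 * Real.pi) hπ) φ),
    fun t => ?_⟩
  rw [timeFourier_eq, FourierTransform.fourier_fourierInv_eq,
    SchwartzMap.compCLMOfContinuousLinearEquiv_apply, Function.comp_apply, scaling_apply,
    mul_inv_cancel_left₀ hπ]

/-- Fourier inversion for Schwartz functions, in the normalization of `timeFourier`. -/
lemma integral_timeFourier_mul_exp (ψ : 𝓢(ℝ, ℂ)) (τ : ℝ) :
    ∫ t : ℝ, timeFourier ψ t * Complex.exp (Complex.I * τ * t) = 2 * Real.pi * ψ τ := by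
  have h := congrArg (fun f : 𝓢(ℝ, ℂ) => f τ) (FourierTransform.fourierInv_fourier_eq (F := 𝓢(ℝ, ℂ)) ψ)
  rw [← h, SchwartzMap.fourierInv_coe, Real.fourierInv_eq']
  have h2 := Measure.integral_comp_mul_left (fun w : ℝ =>
    Complex.exp (↑(2 * Real.pi * inner ℝ w τ) * Complex.I) • (𝓕 ψ) w) (2 * Real.pi)⁻¹
  have hπ : (Real.pi : ℂ) ≠ 0 := by exact_mod_cast Real.pi_ne_zero
  rw [inv_inv, abs_of_pos (by positivity), Complex.real_smul] at h2
  push_cast at h2 ⊢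
  rw [← h2]
  refine integral_congr_ae (.of_forall fun t => ?_)
  simp only [timeFourier_eq, smul_eq_mul]
  rw [mul_comm]
  congr 2
  simp
  field_simp

lemma norm_exp_I_mul (τ t : ℝ) : ‖Complex.exp (Complex.I * τ * t)‖ = 1 := by
  rw [show Complex.I * τ * t = ((τ * t : ℝ) : ℂ) * Complex.I by push_cast; ring]
  exact Complex.norm_exp_ofReal_mul_I _

lemma integrable_mul_exp {f : ℝ → ℂ} (hf : Integrable f) (t : ℝ) :
    Integrable fun τ : ℝ => f τ * Complex.exp (Complex.I * τ * t) :=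
  hf.mul_bdd (c := 1) (by fun_prop) (.of_forall fun τ => (norm_exp_I_mul τ t).le)

lemma continuous_timeFourierInv {f : ℝ → ℂ} (hf : Integrable f) :
    Continuous (timeFourierInv f) := by
  refine continuous_of_dominated (fun t => (integrable_mul_exp hf t).aestronglyMeasurable)
    (fun t => .of_forall fun τ => ?_) hf.norm (.of_forall fun τ => by fun_prop)
  rw [norm_mul, norm_exp_I_mul, mul_one]

/-- Fourier inversion for integrable functions, tested against Schwartz functions. -/
lemma integral_timeFourier_mul_timeFourierInv (ψ : 𝓢(ℝ, ℂ)) {f : ℝ → ℂ} (hf : Integrable f) :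
    ∫ t : ℝ, timeFourier ψ t * timeFourierInv f t = 2 * Real.pi * ∫ τ : ℝ, f τ * ψ τ := by
  obtain ⟨φ, hφ⟩ := exists_schwartz_eq_timeFourier ψ
  have hint : Integrable (fun p : ℝ × ℝ => φ p.1 * f p.2 * Complex.exp (Complex.I * p.2 * p.1))
      (volume.prod volume) :=
    (φ.integrable.mul_prod hf).mul_bdd (c := 1) (by fun_prop)
      (.of_forall fun p => (norm_exp_I_mul p.2 p.1).le)
  calc ∫ t : ℝ, timeFourier ψ t * timeFourierInv f t
      = ∫ t : ℝ, ∫ τ : ℝ, φ t * f τ * Complex.exp (Complex.I * τ * t) := by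
        refine integral_congr_ae (.of_forall fun t => ?_)
        simp only [timeFourierInv, hφ]
        rw [← integral_const_mul]
        simp only [mul_assoc]
    _ = ∫ τ : ℝ, ∫ t : ℝ, φ t * f τ * Complex.exp (Complex.I * τ * t) :=
        integral_integral_swap hint
    _ = ∫ τ : ℝ, 2 * Real.pi * (f τ * ψ τ) := by
        refine integral_congr_ae (.of_forall fun τ => ?_)
        simp only
        rw [mul_left_comm, ← integral_timeFourier_mul_exp, ← integral_const_mul]
        refine integral_congr_ae (.of_forall fun t => ?_)
        simp only [hφ]
        ring
    _ = _ := by rw [integral_const_mul]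

/-- The convolution of complex functions on the line. -/
noncomputable def cconv (f g : ℝ → ℂ) (τ : ℝ) : ℂ := ∫ σ : ℝ, f σ * g (τ - σ)

lemma enorm_cconv_le (f g : ℝ → ℂ) (τ : ℝ) :
    ‖cconv f g τ‖ₑ ≤ lconv (fun σ => ‖f σ‖ₑ) (fun σ => ‖g σ‖ₑ) τ := by
  refine (enorm_integral_le_lintegral_enorm _).trans_eq ?_
  simp only [enorm_mul, lconv]

lemma timeFourierInv_cconv {f g : ℝ → ℂ} (hf : Integrable f) (hg : Integrable g) (t : ℝ) :
    timeFourierInv (cconv f g) t = timeFourierInv f t * timeFourierInv g t := by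
  have h := integral_convolution (ContinuousLinearMap.mul ℂ ℂ) (integrable_mul_exp hf t)
    (integrable_mul_exp hg t) (μ := volume) (ν := volume)
  simp only [ContinuousLinearMap.mul_apply'] at h
  unfold timeFourierInv
  rw [← h]
  refine integral_congr_ae (.of_forall fun τ => ?_)
  simp only [cconv, convolution_def, ContinuousLinearMap.mul_apply']
  rw [← integral_mul_const]
  refine integral_congr_ae (.of_forall fun σ => ?_)
  simp only
  have : Complex.exp (Complex.I * τ * t) =
      Complex.exp (Complex.I * σ * t) * Complex.exp (Complex.I * (τ - σ : ℝ) * t) := by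
    rw [← Complex.exp_add]
    congr 1; push_cast; ring
  rw [this]
  ring

lemma norm_fourier_apply (n : ℤ) (x : Torus) : ‖fourier n x‖ = 1 := by
  rw [fourier_apply]
  exact Circle.norm_coe _

lemma memLp_mul_fourier {g : Torus → ℂ} {μ : Measure Torus} (hg : MemLp g 2 μ) (n : ℤ) :
    MemLp (fun x => g x * fourier n x) 2 μ :=
  hg.of_le (hg.1.mul (by fun_prop)) (.of_forall fun x => by
    rw [norm_mul, norm_fourier_apply, mul_one])

/-- **Parseval's identity** for the product of two functions on the torus, whose measure has total
mass `2π`. -/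
lemma hasSum_fourier_mul {f g : Torus → ℂ} (hf : MemLp f 2) (hg : MemLp g 2) (n : ℤ) :
    HasSum (fun k : ℤ => (∫ x, f x * fourier (-k) x) * ∫ x, g x * fourier (-(n - k)) x)
      (2 * Real.pi * ∫ x, f x * g x * fourier (-n) x) := by
  have hf' := hf.haarAddCircle
  -- The inner product of `L²` is conjugate linear in its first argument.
  have hg' : MemLp (fun x => (starRingEnd ℂ) (g x * fourier (-n) x)) 2
      (AddCircle.haarAddCircle (T := 2 * Real.pi)) :=
    (memLp_mul_fourier hg.haarAddCircle (-n)).star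
  have h := (fourierBasis (T := 2 * Real.pi)).hasSum_inner_mul_inner (hg'.toLp _) (hf'.toLp _)
  have hπ : (Real.pi : ℂ) ≠ 0 := by exact_mod_cast Real.pi_ne_zero
  have haar : ∀ u : Torus → ℂ, ∫ x, u x ∂(AddCircle.haarAddCircle (T := 2 * Real.pi)) =
      (2 * Real.pi : ℂ)⁻¹ * ∫ x, u x := by
    intro u
    rw [AddCircle.integral_haarAddCircle, Complex.real_smul]
    push_cast
    rfl
  have e1 : ∀ k : ℤ, inner ℂ (fourierBasis (T := 2 * Real.pi) k) (hf'.toLp _) =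
      (2 * Real.pi : ℂ)⁻¹ * ∫ x, f x * fourier (-k) x := by
    intro k
    rw [L2.inner_def, ← haar, coe_fourierBasis]
    refine integral_congr_ae ?_
    filter_upwards [coeFn_fourierLp (T := 2 * Real.pi) 2 k, hf'.coeFn_toLp] with x h1 h2
    rw [h1, h2, RCLike.inner_apply', ← fourier_neg, mul_comm]
  have e2 : ∀ k : ℤ, inner ℂ (hg'.toLp _) (fourierBasis (T := 2 * Real.pi) k) =
      (2 * Real.pi : ℂ)⁻¹ * ∫ x, g x * fourier (-(n - k)) x := by
    intro k
    rw [L2.inner_def, ← haar, coe_fourierBasis]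
    refine integral_congr_ae ?_
    filter_upwards [coeFn_fourierLp (T := 2 * Real.pi) 2 k, hg'.coeFn_toLp] with x h1 h2
    rw [h1, h2, RCLike.inner_apply', Complex.conj_conj, mul_assoc, ← fourier_add]
    congr 3
    ring
  have e3 : inner ℂ (hg'.toLp _) (hf'.toLp _) =
      (2 * Real.pi : ℂ)⁻¹ * ∫ x, f x * g x * fourier (-n) x := by
    rw [L2.inner_def, ← haar]
    refine integral_congr_ae ?_
    filter_upwards [hg'.coeFn_toLp, hf'.coeFn_toLp] with x h1 h2
    rw [h1, h2, RCLike.inner_apply', Complex.conj_conj]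
    ring
  simp_rw [e1, e2] at h
  rw [e3] at h
  have e4 : ∀ z : ℂ, 2 * Real.pi * z = (2 * Real.pi : ℂ) ^ 2 * ((2 * Real.pi : ℂ)⁻¹ * z) := by
    intro z
    field_simp
  rw [e4]
  refine (h.mul_left _).congr_fun fun k => ?_
  field_simp

/-! ### The Fourier transform of a product -/

/-- A function whose products with Schwartz functions are integrable is locally integrable: test it
with a bump function that is `1` on a given compact set. -/
lemma locallyIntegrable_of_forall_schwartz {f : ℝ → ℂ}
    (h : ∀ ψ : 𝓢(ℝ, ℂ), Integrable fun τ => f τ * ψ τ) : LocallyIntegrable f := by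
  rw [locallyIntegrable_iff]
  intro K hK
  obtain ⟨R, hR⟩ := hK.isBounded.subset_closedBall 0
  let b : ContDiffBump (0 : ℝ) := ⟨max R 1, max R 1 + 1, by positivity, by linarith⟩
  have hb : ContDiff ℝ (⊤ : ℕ∞) fun x => (b x : ℂ) := Complex.ofRealCLM.contDiff.comp b.contDiff
  have hbs : HasCompactSupport fun x => (b x : ℂ) :=
    b.hasCompactSupport.comp_left Complex.ofReal_zero
  have hi := (h (hbs.toSchwartzMap hb)).integrableOn (s := K)
  refine hi.congr_fun (fun x hx => ?_) hK.measurableSet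
  have h1 : b x = 1 := b.one_of_mem_closedBall
    (Metric.closedBall_subset_closedBall (le_max_left R 1) (hR hx))
  simp [h1]

lemma IsFourierTransform.aestronglyMeasurable {T : SpaceTimeDistribution} {F : ℤ → ℝ → ℂ}
    (h : IsFourierTransform T F) (n : ℤ) : AEStronglyMeasurable (F n) :=
  (locallyIntegrable_of_forall_schwartz fun ψ => (h n ψ).1).aestronglyMeasurable

lemma IsFourierTransform.congr {T : SpaceTimeDistribution} {F F' : ℤ → ℝ → ℂ}
    (h : IsFourierTransform T F) (hF : ∀ n, F n =ᵐ[volume] F' n) : IsFourierTransform T F' := by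
  intro n ψ
  have e : (fun τ => F n τ * ψ τ) =ᵐ[volume] fun τ => F' n τ * ψ τ := by
    filter_upwards [hF n] with τ hτ
    rw [hτ]
  exact ⟨(h n ψ).1.congr e, (h n ψ).2.trans (integral_congr_ae e)⟩

lemma hatNormY_congr (α s₁ s₂ : ℝ) {F F' : ℤ → ℝ → ℂ} (hF : ∀ n, F n =ᵐ[volume] F' n) :
    hatNormY α s₁ s₂ F = hatNormY α s₁ s₂ F' := by
  have e : ∀ (s b : ℝ) (n : ℤ), weighted α s b F n =ᵐ[volume] weighted α s b F' n := by
    intro s b n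
    filter_upwards [hF n] with τ hτ
    simp only [weighted, hτ]
  have e1 : ∀ (s b : ℝ) (n : ℤ), ∫⁻ τ, weighted α s b F n τ = ∫⁻ τ, weighted α s b F' n τ :=
    fun s b n => lintegral_congr_ae (e s b n)
  have e2 : ∀ (s b : ℝ) (n : ℤ),
      ∫⁻ τ, weighted α s b F n τ ^ 2 = ∫⁻ τ, weighted α s b F' n τ ^ 2 :=
    fun s b n => lintegral_congr_ae ((e s b n).fun_comp (· ^ 2))
  simp only [hatNormY, normL2L2, normL2L1, normLinfL2, normLinfL1, e1, e2]

/-- The `n`-th Fourier coefficient in space of a function on `Torus × ℝ`, at time `t`. -/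
noncomputable def spatialCoeff (v : Torus × ℝ → ℂ) (n : ℤ) (t : ℝ) : ℂ :=
  ∫ x : Torus, v (x, t) * fourier (-n) x

lemma memLp_fourier_mul_schwartz (n : ℤ) (φ : 𝓢(ℝ, ℂ)) :
    MemLp (fun p : Torus × ℝ => fourier n p.1 * φ p.2) 2 := by
  have hm : AEStronglyMeasurable (fun p : Torus × ℝ => fourier n p.1 * φ p.2) :=
    (by fun_prop : Continuous fun p : Torus × ℝ => fourier n p.1 * φ p.2).aestronglyMeasurable
  rw [memLp_two_iff_integrable_sq_norm hm]
  have h1 : Integrable fun t => ‖φ t‖ ^ 2 :=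
    (memLp_two_iff_integrable_sq_norm φ.continuous.aestronglyMeasurable).1 (φ.memLp 2)
  have h2 : Integrable (fun _ : Torus => (1 : ℝ)) := integrable_const _
  refine (h2.mul_prod h1).congr (.of_forall fun p => ?_)
  simp only [norm_mul, norm_fourier_apply, one_mul]

lemma integrable_mul_testFunction {v : Torus × ℝ → ℂ} (hv : MemLp v 2) (n : ℤ) (φ : 𝓢(ℝ, ℂ)) :
    Integrable (fun p : Torus × ℝ => v p * (fourier n p.1 * φ p.2)) (volume.prod volume) :=
  hv.integrable_mul (memLp_fourier_mul_schwartz n φ)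

lemma integrable_spatialCoeff_mul {v : Torus × ℝ → ℂ} (hv : MemLp v 2) (n : ℤ) (φ : 𝓢(ℝ, ℂ)) :
    Integrable fun t => spatialCoeff v n t * φ t := by
  refine (integrable_mul_testFunction hv (-n) φ).integral_prod_right.congr (.of_forall fun t => ?_)
  simp only [spatialCoeff, ← integral_mul_const, mul_assoc]

lemma ofFunction_testFunction (v : Torus × ℝ → ℂ) (n : ℤ) (ψ : 𝓢(ℝ, ℂ))
    (hv : ∀ φ : 𝓢(ℝ, ℂ), Integrable (fun p : Torus × ℝ => v p * (fourier (-n) p.1 * φ p.2))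
      (volume.prod volume)) :
    ofFunction v (testFunction n ψ) = ∫ t : ℝ, timeFourier ψ t * spatialCoeff v n t := by
  obtain ⟨φ, hφ⟩ := exists_schwartz_eq_timeFourier ψ
  have e : testFunction n ψ = fun p => fourier (-n) p.1 * φ p.2 := by
    ext p
    rw [← hφ]
    rfl
  rw [ofFunction, e, Measure.volume_eq_prod, integral_prod_symm _ (hv φ)]
  refine integral_congr_ae (.of_forall fun t => ?_)
  simp only [spatialCoeff, hφ]
  rw [← integral_const_mul]
  refine integral_congr_ae (.of_forall fun x => ?_)
  simp only
  ring

/-- When the Fourier transform of `v` is integrable in `τ`, Fourier inversion in time recovers the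
Fourier coefficients in space of `v`. -/
lemma spatialCoeff_ae_eq {v : Torus × ℝ → ℂ} (hv : MemLp v 2) {F : ℤ → ℝ → ℂ}
    (hF : IsFourierTransform (ofFunction v) F) {n : ℤ} (hFn : Integrable (F n)) :
    ∀ᵐ t : ℝ, spatialCoeff v n t = (2 * Real.pi : ℂ)⁻¹ * timeFourierInv (F n) t := by
  have hπ : (Real.pi : ℂ) ≠ 0 := by exact_mod_cast Real.pi_ne_zero
  refine ae_eq_of_integral_contDiff_smul_eq
    (locallyIntegrable_of_forall_schwartz (integrable_spatialCoeff_mul hv n))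
    ((continuous_timeFourierInv hFn).const_mul _).locallyIntegrable fun g hg hgs => ?_
  have hb : ContDiff ℝ (⊤ : ℕ∞) fun x => (g x : ℂ) := Complex.ofRealCLM.contDiff.comp hg
  have hbs : HasCompactSupport fun x => (g x : ℂ) := hgs.comp_left Complex.ofReal_zero
  obtain ⟨ψ, hψ⟩ := exists_timeFourier_eq (hbs.toSchwartzMap hb)
  have hψ' : ∀ t, timeFourier ψ t = (g t : ℂ) := hψ
  have h1 := ofFunction_testFunction v n ψ (integrable_mul_testFunction hv (-n))
  have h2 := integral_timeFourier_mul_timeFourierInv ψ hFn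
  rw [(hF n ψ).2] at h1
  simp only [hψ'] at h1 h2
  simp only [Complex.real_smul]
  rw [← h1]
  simp_rw [mul_left_comm (g _ : ℂ)]
  rw [integral_const_mul, h2]
  field_simp

lemma ae_memLp_slice {v : Torus × ℝ → ℂ} (hv : MemLp v 2) :
    ∀ᵐ t : ℝ, MemLp (fun x : Torus => v (x, t)) 2 := by
  have hm : AEStronglyMeasurable v (volume.prod volume) := hv.1
  have hi : Integrable (fun p => ‖v p‖ ^ 2) (volume.prod volume) :=
    (memLp_two_iff_integrable_sq_norm hm).1 hv
  filter_upwards [hm.prodMk_right, hi.prod_left_ae] with t h1 h2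
  exact (memLp_two_iff_integrable_sq_norm h1).2 h2

/-- The convolution of two functions on `ℤ × ℝ`. The sum over `k` converges absolutely for almost
every `τ` when `tsum_lintegral_cconv_ne_top` applies, and has the junk value `0` where it does not
converge. -/
noncomputable def spaceTimeConv (F₁ F₂ : ℤ → ℝ → ℂ) (n : ℤ) (τ : ℝ) : ℂ :=
  ∑' k : ℤ, cconv (F₁ k) (F₂ (n - k)) τ

lemma measurable_cconv {f g : ℝ → ℂ} (hf : Measurable f) (hg : Measurable g) :
    Measurable (cconv f g) := by
  have h : Measurable fun p : ℝ × ℝ => f p.2 * g (p.1 - p.2) := by fun_prop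
  exact h.stronglyMeasurable.integral_prod_right.measurable

lemma enorm_spaceTimeConv_le (F₁ F₂ : ℤ → ℝ → ℂ) (n : ℤ) (τ : ℝ) :
    ‖spaceTimeConv F₁ F₂ n τ‖ₑ ≤
      ∑' k : ℤ, lconv (fun σ => ‖F₁ k σ‖ₑ) (fun σ => ‖F₂ (n - k) σ‖ₑ) τ :=
  enorm_tsum_le_tsum_enorm.trans (ENNReal.tsum_le_tsum fun _ => enorm_cconv_le _ _ _)

section spaceTimeConv

variable {F₁ F₂ : ℤ → ℝ → ℂ} (hF₁ : ∀ n, Measurable (F₁ n)) (hF₂ : ∀ n, Measurable (F₂ n)) {n : ℤ}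
  (hsum : ∑' k : ℤ, (∫⁻ τ, ‖F₁ k τ‖ₑ) * ∫⁻ τ, ‖F₂ (n - k) τ‖ₑ ≠ ⊤)

include hF₁ hF₂ hsum

lemma tsum_lintegral_cconv_ne_top :
    ∑' k : ℤ, ∫⁻ τ, ‖cconv (F₁ k) (F₂ (n - k)) τ‖ₑ ≠ ⊤ := by
  refine ne_top_of_le_ne_top hsum (ENNReal.tsum_le_tsum fun k => ?_)
  rw [← lintegral_lconv (hF₁ k).enorm (hF₂ (n - k)).enorm]
  exact lintegral_mono fun τ => enorm_cconv_le _ _ _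

lemma integrable_spaceTimeConv : Integrable (spaceTimeConv F₁ F₂ n) := by
  have hm : ∀ k, Measurable (cconv (F₁ k) (F₂ (n - k))) := fun k =>
    measurable_cconv (hF₁ k) (hF₂ (n - k))
  refine ⟨(Measurable.tsum hm).aestronglyMeasurable, ?_⟩
  calc ∫⁻ τ, ‖spaceTimeConv F₁ F₂ n τ‖ₑ
      ≤ ∫⁻ τ, ∑' k, ‖cconv (F₁ k) (F₂ (n - k)) τ‖ₑ :=
        lintegral_mono fun τ => enorm_tsum_le_tsum_enorm
    _ = ∑' k, ∫⁻ τ, ‖cconv (F₁ k) (F₂ (n - k)) τ‖ₑ :=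
        lintegral_tsum fun k => (hm k).enorm.aemeasurable
    _ < ⊤ := (tsum_lintegral_cconv_ne_top hF₁ hF₂ hsum).lt_top

lemma timeFourierInv_spaceTimeConv (hi₁ : ∀ k, Integrable (F₁ k)) (hi₂ : ∀ k, Integrable (F₂ k))
    (t : ℝ) : timeFourierInv (spaceTimeConv F₁ F₂ n) t =
      ∑' k : ℤ, timeFourierInv (F₁ k) t * timeFourierInv (F₂ (n - k)) t := by
  have hm : ∀ k, Measurable (cconv (F₁ k) (F₂ (n - k))) := fun k =>
    measurable_cconv (hF₁ k) (hF₂ (n - k))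
  simp_rw [← timeFourierInv_cconv (hi₁ _) (hi₂ _)]
  unfold timeFourierInv
  rw [← integral_tsum]
  · simp_rw [tsum_mul_right, spaceTimeConv]
  · intro k
    exact ((hm k).mul (by fun_prop)).aestronglyMeasurable
  · have he : ∀ τ : ℝ, ‖Complex.exp (Complex.I * τ * t)‖ₑ = 1 := by
      intro τ
      rw [← ofReal_norm, norm_exp_I_mul, ENNReal.ofReal_one]
    simp_rw [enorm_mul, he, mul_one]
    exact tsum_lintegral_cconv_ne_top hF₁ hF₂ hsum

/-- Up to the factor `(2π)⁻²`, the Fourier transform of a product is the convolution of the Fourier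
transforms. -/
lemma ofFunction_mul_testFunction {v₁ v₂ : Torus × ℝ → ℂ} (hv₁ : MemLp v₁ 2) (hv₂ : MemLp v₂ 2)
    (h₁ : IsFourierTransform (ofFunction v₁) F₁) (h₂ : IsFourierTransform (ofFunction v₂) F₂)
    (hi₁ : ∀ k, Integrable (F₁ k)) (hi₂ : ∀ k, Integrable (F₂ k)) (ψ : 𝓢(ℝ, ℂ)) :
    ofFunction (fun p => v₁ p * v₂ p) (testFunction n ψ) =
      ((2 * Real.pi : ℂ) ^ 2)⁻¹ * ∫ τ : ℝ, spaceTimeConv F₁ F₂ n τ * ψ τ := by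
  have hπ : (Real.pi : ℂ) ≠ 0 := by exact_mod_cast Real.pi_ne_zero
  have hprod : Integrable (fun p => v₁ p * v₂ p) (volume.prod volume) := hv₁.integrable_mul hv₂
  have hcoeff : ∀ᵐ t : ℝ, spatialCoeff (fun p => v₁ p * v₂ p) n t =
      ((2 * Real.pi : ℂ) ^ 3)⁻¹ * timeFourierInv (spaceTimeConv F₁ F₂ n) t := by
    filter_upwards [ae_memLp_slice hv₁, ae_memLp_slice hv₂,
      ae_all_iff.2 fun k => spatialCoeff_ae_eq hv₁ h₁ (hi₁ k),
      ae_all_iff.2 fun k => spatialCoeff_ae_eq hv₂ h₂ (hi₂ k)] with t m₁ m₂ c₁ c₂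
    have hP := (hasSum_fourier_mul m₁ m₂ n).tsum_eq
    rw [timeFourierInv_spaceTimeConv hF₁ hF₂ hsum hi₁ hi₂]
    have e : ∀ k : ℤ, timeFourierInv (F₁ k) t * timeFourierInv (F₂ (n - k)) t =
        (2 * Real.pi : ℂ) ^ 2 * ((∫ x, v₁ (x, t) * fourier (-k) x) *
          ∫ x, v₂ (x, t) * fourier (-(n - k)) x) := by
      intro k
      have d₁ := c₁ k
      have d₂ := c₂ (n - k)
      unfold spatialCoeff at d₁ d₂
      rw [d₁, d₂]
      field_simp
    simp_rw [e]
    rw [tsum_mul_left, hP]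
    unfold spatialCoeff
    field_simp
  rw [ofFunction_testFunction]
  · have h := integral_timeFourier_mul_timeFourierInv ψ
      (integrable_spaceTimeConv hF₁ hF₂ hsum)
    calc ∫ t : ℝ, timeFourier ψ t * spatialCoeff (fun p => v₁ p * v₂ p) n t
        = ∫ t : ℝ, ((2 * Real.pi : ℂ) ^ 3)⁻¹ *
            (timeFourier ψ t * timeFourierInv (spaceTimeConv F₁ F₂ n) t) := by
          refine integral_congr_ae ?_
          filter_upwards [hcoeff] with t ht
          rw [ht]
          ring
      _ = _ := by
          rw [integral_const_mul, h]
          field_simp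
  · intro φ
    obtain ⟨C, hC⟩ : ∃ C, ∀ x, ‖φ x‖ ≤ C := ⟨_, φ.norm_le_seminorm ℂ⟩
    refine hprod.mul_bdd (c := C) ?_ (.of_forall fun p => ?_)
    · exact (by fun_prop : Continuous fun p : Torus × ℝ =>
        fourier (-n) p.1 * φ p.2).aestronglyMeasurable
    · rw [norm_mul, norm_fourier_apply, one_mul]
      exact hC _

end spaceTimeConv

lemma partialX_testFunction (n : ℤ) (ψ : 𝓢(ℝ, ℂ)) :
    partialX (testFunction n ψ) = fun p => -(Complex.I * n) * testFunction n ψ p := by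
  ext ⟨x, t⟩
  induction x using QuotientAddGroup.induction_on with
  | H x =>
    have h := hasDerivAt_fourier_neg (2 * Real.pi) n (x + 0)
    have h2 := (h.comp_const_add x 0).mul_const
      (∫ τ : ℝ, ψ τ * Complex.exp (-(Complex.I * τ * t)))
    have hπ : (Real.pi : ℂ) ≠ 0 := by exact_mod_cast Real.pi_ne_zero
    refine h2.deriv.trans ?_
    simp only [testFunction, add_zero]
    generalize ∫ τ : ℝ, ψ τ * Complex.exp (-(Complex.I * τ * t)) = J
    push_cast
    field_simp

/-! ### The bilinear estimate for functions -/

lemma isFourierTransform_distribX_mul {v₁ v₂ : Torus × ℝ → ℂ} {F₁ F₂ : ℤ → ℝ → ℂ}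
    (hv₁ : MemLp v₁ 2) (hv₂ : MemLp v₂ 2) (hF₁ : ∀ n, Measurable (F₁ n))
    (hF₂ : ∀ n, Measurable (F₂ n)) (h₁ : IsFourierTransform (ofFunction v₁) F₁)
    (h₂ : IsFourierTransform (ofFunction v₂) F₂) (hi₁ : ∀ k, Integrable (F₁ k))
    (hi₂ : ∀ k, Integrable (F₂ k))
    (hsum : ∀ n, ∑' k : ℤ, (∫⁻ τ, ‖F₁ k τ‖ₑ) * ∫⁻ τ, ‖F₂ (n - k) τ‖ₑ ≠ ⊤) :
    IsFourierTransform (distribX (ofFunction fun p => v₁ p * v₂ p))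
      (fun n τ => Complex.I * n * ((2 * Real.pi : ℂ) ^ 2)⁻¹ * spaceTimeConv F₁ F₂ n τ) := by
  intro n ψ
  constructor
  · simp_rw [mul_assoc _ (spaceTimeConv F₁ F₂ n _)]
    refine Integrable.const_mul ?_ _
    exact (integrable_spaceTimeConv hF₁ hF₂ (hsum n)).mul_bdd
      (c := SchwartzMap.seminorm ℂ 0 0 ψ) ψ.continuous.aestronglyMeasurable
      (.of_forall (ψ.norm_le_seminorm ℂ))
  · have h := ofFunction_mul_testFunction hF₁ hF₂ (hsum n) hv₁ hv₂ h₁ h₂ hi₁ hi₂ ψ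
    unfold ofFunction at h
    unfold distribX ofFunction
    rw [partialX_testFunction]
    simp_rw [mul_left_comm _ (-(Complex.I * (n : ℂ))), mul_assoc _ (spaceTimeConv F₁ F₂ n _)]
    rw [integral_const_mul, integral_const_mul, h]
    ring

/-- As `s₁ ≥ 0`, the `L²_n L¹_τ` part of the `Y` norm controls the unweighted norm. -/
lemma tsum_sq_lintegral_ne_top {α s₁ s₂ : ℝ} (hs₁ : 0 ≤ s₁) {F : ℤ → ℝ → ℂ}
    (h : hatNormY α s₁ s₂ F < ⊤) : ∑' n, (∫⁻ τ, ‖F n τ‖ₑ) ^ 2 ≠ ⊤ := by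
  have h1 : normL2L1 (weighted α s₁ 0 F) < ⊤ :=
    lt_of_le_of_lt (le_trans le_add_self le_self_add) h
  unfold normL2L1 at h1
  rw [ENNReal.rpow_lt_top_iff_of_pos (by norm_num)] at h1
  refine ne_top_of_le_ne_top h1.ne (ENNReal.tsum_le_tsum fun n => ?_)
  gcongr with τ
  rw [weighted, Real.rpow_zero, mul_one]
  exact le_mul_of_one_le_left' (one_le_ofReal_bracket_rpow _ hs₁)

lemma integrable_of_tsum_sq_ne_top {F : ℤ → ℝ → ℂ} (hF : ∀ n, Measurable (F n))
    (h : ∑' n, (∫⁻ τ, ‖F n τ‖ₑ) ^ 2 ≠ ⊤) (n : ℤ) : Integrable (F n) := by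
  refine ⟨(hF n).aestronglyMeasurable, ?_⟩
  have := ENNReal.ne_top_of_tsum_ne_top h n
  simpa [HasFiniteIntegral, lt_top_iff_ne_top] using this

lemma tsum_mul_shift_ne_top {a b : ℤ → ℝ≥0∞} (ha : ∑' n, a n ^ 2 ≠ ⊤) (hb : ∑' n, b n ^ 2 ≠ ⊤)
    (n : ℤ) : ∑' k, a k * b (n - k) ≠ ⊤ := by
  have h := sq_tsum_mul_le a fun k => b (n - k)
  have e := (Equiv.subLeft n).tsum_eq fun k => b k ^ 2
  simp only [Equiv.subLeft_apply] at e
  rw [e] at h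
  exact fun htop => ENNReal.mul_ne_top ha hb (top_le_iff.1 (by simpa [htop] using h))

lemma le_mul_of_forall_lt {z c y : ℝ≥0∞} (hc : c ≠ ⊤) (hy : y < ⊤)
    (h : ∀ b, y < b → z ≤ c * b) : z ≤ c * y := by
  have : (nhdsWithin y (Set.Ioi y)).NeBot := nhdsGT_neBot_of_exists_gt ⟨⊤, hy⟩
  have ht : Filter.Tendsto (fun b => c * b) (nhdsWithin y (Set.Ioi y)) (nhds (c * y)) :=
    ((ENNReal.continuous_const_mul hc).tendsto y).mono_left nhdsWithin_le_nhds
  exact ge_of_tendsto ht (Filter.eventually_of_mem self_mem_nhdsWithin fun b hb => h b hb)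

/-- The bilinear estimate. It holds for every choice of Fourier transforms of `v₁` and `v₂`, hence
for the infima that define the `Y` norms. -/
lemma exists_normZ_le {α ν s₁ s₂ : ℝ} (h0 : 0 < α) (h4 : α < 4) (h1 : α ≠ 1)
    (hν : IsOfType (c₁ α) ν) (hν0 : 0 < ν) (hs₁ : 1 / 4 ≤ s₁) (hs₂ : 1 / 2 + ν / 2 ≤ s₂) :
    ∃ C : ℝ≥0∞, C ≠ ⊤ ∧ ∀ v₁ v₂ : Torus × ℝ → ℂ, MemY α s₁ s₂ v₁ → MemY α s₁ s₂ v₂ →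
      normZ s₁ (distribX (ofFunction fun p => v₁ p * v₂ p)) ≤
        C * normY α s₁ s₂ (ofFunction v₁) * normY α s₁ s₂ (ofFunction v₂) := by
  obtain ⟨C, hC, h⟩ := exists_hatNormZ_le h0 h4 h1 hν hν0 hs₁ hs₂
  have hs₁0 : 0 ≤ s₁ := by linarith
  refine ⟨C, hC, fun v₁ v₂ hv₁ hv₂ => ?_⟩
  have key : ∀ F₁ F₂ : ℤ → ℝ → ℂ, IsFourierTransform (ofFunction v₁) F₁ →
      IsFourierTransform (ofFunction v₂) F₂ → hatNormY α s₁ s₂ F₁ < ⊤ →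
      hatNormY α s₁ s₂ F₂ < ⊤ → normZ s₁ (distribX (ofFunction fun p => v₁ p * v₂ p)) ≤
        C * (hatNormY α s₁ s₂ F₁ * hatNormY α s₁ s₂ F₂) := by
    intro F₁ F₂ hF₁ hF₂ hn₁ hn₂
    -- Pass to measurable representatives of the Fourier transforms.
    have he₁ := fun n => (hF₁.aestronglyMeasurable n).ae_eq_mk
    have he₂ := fun n => (hF₂.aestronglyMeasurable n).ae_eq_mk
    have hm₁ := fun n => (hF₁.aestronglyMeasurable n).stronglyMeasurable_mk.measurable
    have hm₂ := fun n => (hF₂.aestronglyMeasurable n).stronglyMeasurable_mk.measurable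
    replace hF₁ := hF₁.congr he₁
    replace hF₂ := hF₂.congr he₂
    rw [hatNormY_congr α s₁ s₂ he₁] at hn₁ ⊢
    rw [hatNormY_congr α s₁ s₂ he₂] at hn₂ ⊢
    have ht₁ := tsum_sq_lintegral_ne_top hs₁0 hn₁
    have ht₂ := tsum_sq_lintegral_ne_top hs₁0 hn₂
    have hG := isFourierTransform_distribX_mul hv₁.1 hv₂.1 hm₁ hm₂ hF₁ hF₂
      (integrable_of_tsum_sq_ne_top hm₁ ht₁) (integrable_of_tsum_sq_ne_top hm₂ ht₂)
      (fun n => tsum_mul_shift_ne_top ht₁ ht₂ n)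
    refine (iInf₂_le _ hG).trans (h _ _ _ hm₁ hm₂ fun n τ => ?_)
    rw [enorm_mul]
    refine mul_le_mul' ?_ (enorm_spaceTimeConv_le _ _ _ _)
    rw [← ofReal_norm]
    refine ENNReal.ofReal_le_ofReal ?_
    have hπ : 1 ≤ (2 * Real.pi) ^ 2 := by nlinarith [Real.pi_gt_three]
    rw [norm_mul, norm_mul, Complex.norm_I, one_mul, Complex.norm_intCast, norm_inv, norm_pow,
      norm_mul, Complex.norm_ofNat, Complex.norm_real, Real.norm_of_nonneg Real.pi_pos.le]
    exact mul_le_of_le_one_right (abs_nonneg _) (inv_le_one_of_one_le₀ hπ)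
  have step : ∀ F₁ : ℤ → ℝ → ℂ, IsFourierTransform (ofFunction v₁) F₁ →
      hatNormY α s₁ s₂ F₁ < ⊤ → normZ s₁ (distribX (ofFunction fun p => v₁ p * v₂ p)) ≤
        C * hatNormY α s₁ s₂ F₁ * normY α s₁ s₂ (ofFunction v₂) := by
    intro F₁ hF₁ hn₁
    refine le_mul_of_forall_lt (ENNReal.mul_ne_top hC hn₁.ne) hv₂.2 fun b hb => ?_
    simp only [normY, iInf_lt_iff] at hb
    obtain ⟨F₂, hF₂, hlt⟩ := hb
    refine (key F₁ F₂ hF₁ hF₂ hn₁ (hlt.trans_le le_top)).trans ?_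
    rw [← mul_assoc]
    gcongr
  rw [mul_right_comm]
  refine le_mul_of_forall_lt (ENNReal.mul_ne_top hC hv₂.2.ne) hv₁.2 fun b hb => ?_
  simp only [normY, iInf_lt_iff] at hb
  obtain ⟨F₁, hF₁, hlt⟩ := hb
  refine (step F₁ hF₁ (hlt.trans_le le_top)).trans ?_
  rw [mul_right_comm]
  gcongr

end KdVSystem

theorem mainTheorem3 (α s₁ s₂ : ℝ) (hα_pos : 0 < α) (hα_lt : α < 4) (hα_ne : α ≠ 1)
    (hν : KdVSystem.minimalTypeIndex (KdVSystem.c₁ α) < 1)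
    (hs₁ : 1 / 4 ≤ s₁) (hs₁' : s₁ < 1 / 2) (hs₂ : 1 / 2 < s₂) (hs₂' : s₂ < 1)
    (hs₂ν : 1 / 2 + (KdVSystem.minimalTypeIndex (KdVSystem.c₁ α)).toReal / 2 < s₂) :
    (∃ C : ℝ, 0 < C ∧ ∀ v₁ v₂ : KdVSystem.Torus × ℝ → ℂ,
      KdVSystem.MemY α s₁ s₂ v₁ → KdVSystem.MemY α s₁ s₂ v₂ →
        KdVSystem.normZ s₁ (KdVSystem.distribX (KdVSystem.ofFunction (fun p => v₁ p * v₂ p))) ≤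
          ENNReal.ofReal C * KdVSystem.normY α s₁ s₂ (KdVSystem.ofFunction v₁) *
            KdVSystem.normY α s₁ s₂ (KdVSystem.ofFunction v₂)) ∧
    (∀ ε : ℝ, 0 < ε → ∃ c : ℝ, 0 < c ∧ ∀ n n₁ n₂ : ℤ, n = n₁ + n₂ → n ≠ 0 →
      c * |(n : ℝ)| ^ (1 - (KdVSystem.minimalTypeIndex (KdVSystem.c₁ α)).toReal - ε) ≤
        |(n : ℝ) ^ 3 - α * (n₁ : ℝ) ^ 3 - α * (n₂ : ℝ) ^ 3|) := by
  have hfin : KdVSystem.minimalTypeIndex (KdVSystem.c₁ α) ≠ ⊤ := (hν.trans ENNReal.one_lt_top).ne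
  constructor
  -- The lower bound on `s₂` leaves room for a type `ν` with `1 / 2 + ν / 2 < s₂`.
  · obtain ⟨ν, hν0, hνlt, hty⟩ := KdVSystem.exists_isOfType_lt (μ := 2 * s₂ - 1) hfin (by linarith)
    obtain ⟨C, hC, h⟩ := KdVSystem.exists_normZ_le hα_pos hα_lt hα_ne hty hν0 hs₁
      (by linarith : 1 / 2 + ν / 2 ≤ s₂)
    refine ⟨C.toReal + 1, by positivity, fun v₁ v₂ hv₁ hv₂ => (h v₁ v₂ hv₁ hv₂).trans ?_⟩
    gcongr
    calc C = ENNReal.ofReal C.toReal := (ENNReal.ofReal_toReal hC).symm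
      _ ≤ _ := ENNReal.ofReal_le_ofReal (by linarith)
  · intro ε hε
    obtain ⟨ν, hν0, hνlt, hty⟩ := KdVSystem.exists_isOfType_lt
      (μ := (KdVSystem.minimalTypeIndex (KdVSystem.c₁ α)).toReal + ε) hfin (by linarith)
    obtain ⟨κ, hκ, h⟩ := KdVSystem.abs_resonance_ge_rpow hα_pos hα_lt hty
    refine ⟨κ, hκ, fun n n₁ n₂ hn hn0 => ?_⟩
    subst hn
    refine le_trans ?_ (h n₁ n₂ hn0)
    have h1 : (1 : ℝ) ≤ |((n₁ + n₂ : ℤ) : ℝ)| := by exact_mod_cast Int.one_le_abs hn0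
    exact mul_le_mul_of_nonneg_left (Real.rpow_le_rpow_of_exponent_le h1 (by linarith)) hκ.le
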